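/- Let $k, r, s \ge 0$ be integers with $k \le s$, put $n = k + r$, and let $\mathbf a = (s-1, \dots, s-1)$ be the constant sequence of length $r$, where $s \ge 1$ if $r \ge 1$ (so that the entries are nonnegative). Let $\mathbb{Q}[\mathbf{x}_n, \boldsymbol\theta_n]$ be the unital associative $\mathbb{Q}$-algebra on $x_1, \dots, x_n, \theta_1, \dots, \theta_n$ with relations $x_i x_j = x_j x_i$, $x_i\theta_j = \theta_j x_i$, $\theta_i\theta_j = -\theta_j\theta_i$, with the diagonal action $w\cdot x_i = x_{w(i)}$, $w \cdot \theta_i = \theta_{w(i)}$ of the symmetric group $\mathfrak{S}_n$, and let $\partial_i$ be partial differentiation with respect to $x_i$, treating the $\theta_j$ as constants. Put $$\Delta_n(\mathbf a) = \sum_{w \in \mathfrak{S}_n} \mathrm{sign}(w)\, w\cdot\left(x_1^{a_1} \cdots x_r^{a_r}\, x_{r+1}^{k-1} x_{r+2}^{k-2} \cdots x_{n-1}^{1} x_n^0 \cdot \theta_1 \theta_2 \cdots \theta_r\right),$$ and let $V_n(\mathbf a)$ be the smallest $\mathbb{Q}$-subspace of $\mathbb{Q}[\mathbf{x}_n, \boldsymbol\theta_n]$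 that contains $\Delta_n(\mathbf a)$ and is closed under $\partial_1, \dots, \partial_n$; it is an $\mathfrak{S}_n$-module, graded by $x$-degree. Let $R_{n,k,s} = \mathbb{Q}[x_1, \dots, x_n]/I_{n,k,s}$, where $$I_{n,k,s} = \langle x_1^s, \dots, x_n^s,\ e_n, e_{n-1}, \dots, e_{n-k+1} \rangle$$ and $e_d$ is the elementary symmetric polynomial of degree $d$ in $x_1, \dots, x_n$; it is an $\mathfrak{S}_n$-module graded by degree. For a graded $\mathfrak{S}_n$-module $V = \bigoplus_{d \ge 0} V_d$ with finite-dimensional pieces let $\mathrm{grFrob}(V; q) = \sum_{d} \mathrm{Frob}(V_d)\, q^d$, where $\mathrm{Frob}(W) = \sum_{\lambda \vdash n} m_\lambda s_\lambda$ if $W$ contains the irreducible module $S^\lambda$ with multiplicity $m_\lambda$, and $s_\lambda$ is the Schur function. Let $\omega$ be the linear map on symmetric functions with $\omega(s_\lambda) = s_{\lambda'}$, applied to polynomials in $q$ coefficientwise, and let $\mathrm{rev}_q F = q^{d} F(q^{-1})$ for a polynomial $F$ of degree $d$ in $q$ (with $\mathrm{rev}_q 0 = 0$). Then $V_n(\mathbf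 a)$ and $R_{n,k,s}$ are finite-dimensional and $$\mathrm{grFrob}(V_n(\mathbf a); q) = (\mathrm{rev}_q \circ \omega)\, \mathrm{grFrob}(R_{n,k,s}; q).$$ Moreover, $I_{n,k,s}$ is the annihilator of $\Delta_n(\mathbf a)$: a polynomial $f \in \mathbb{Q}[x_1, \dots, x_n]$ lies in $I_{n,k,s}$ if and only if $f(\partial_1, \dots, \partial_n)\, \Delta_n(\mathbf a) = 0$. -/

import Mathlib

open MvPolynomial TensorProduct

noncomputable section

namespace SuperVandermonde

/-! ### Symmetric functions: Schur functions, the space `Λ`, and the involution `ω` -/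

/-- The content of a semistandard tableau: the exponent vector of the monomial `∏ x_{T(c)}` over the
cells `c`.  The entries, like the variables `x₀, x₁, x₂, …`, are indexed by `ℕ`. -/
def content {μ : YoungDiagram} (T : SemistandardYoungTableau μ) : ℕ →₀ ℕ :=
  ∑ c ∈ μ.cells, Finsupp.single (T c.1 c.2) 1

/-- The Schur function `s_μ = ∑_T x^{content T}` (sum over all semistandard tableaux of shape `μ`),
a formal power series in infinitely many variables. -/
def schur (μ : YoungDiagram) : MvPowerSeries ℕ ℚ :=
  fun m => (Nat.card {T : SemistandardYoungTableau μ // content T = m} : ℚ)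

/-- The space `Λ` of symmetric functions over `ℚ`, presented as the span of its basis of Schur
functions. -/
def Lam : Submodule ℚ (MvPowerSeries ℕ ℚ) := Submodule.span ℚ (Set.range schur)

/-- The number of cells of `μ` in the first `k` rows. -/
def topCells (μ : YoungDiagram) (k : ℕ) : ℕ := (μ.cells.filter fun c => c.1 < k).card

theorem rowLen_add_topCells (μ : YoungDiagram) (k : ℕ) :
    topCells μ (k + 1) = topCells μ k + μ.rowLen k := by
  classical
  rw [YoungDiagram.rowLen_eq_card, topCells, topCells, YoungDiagram.row,
    ← Finset.card_union_of_disjoint]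
  · congr 1
    ext c
    simp only [Finset.mem_filter, Finset.mem_union]
    constructor
    · rintro ⟨h1, h2⟩
      rcases Nat.lt_succ_iff_lt_or_eq.mp h2 with h | h
      · exact Or.inl ⟨h1, h⟩
      · exact Or.inr ⟨h1, h⟩
    · rintro (⟨h1, h2⟩ | ⟨h1, h2⟩)
      · exact ⟨h1, by omega⟩
      · exact ⟨h1, by omega⟩
  · rw [Finset.disjoint_filter]
    intro c _ h1 h2
    omega

theorem topCells_injective : Function.Injective topCells := by
  intro μ ν h
  have hr : ∀ k, μ.rowLen k = ν.rowLen k := fun k => by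
    have h1 := rowLen_add_topCells μ k
    have h2 := rowLen_add_topCells ν k
    rw [h] at h1
    omega
  apply YoungDiagram.ext
  ext ⟨i, j⟩
  rw [YoungDiagram.mem_cells, YoungDiagram.mem_cells, YoungDiagram.mem_iff_lt_rowLen,
    YoungDiagram.mem_iff_lt_rowLen, hr]

theorem sum_content {μ : YoungDiagram} (T : SemistandardYoungTableau μ) (k : ℕ) :
    ∑ v ∈ Finset.range k, content T v = (μ.cells.filter fun c => T c.1 c.2 < k).card := by
  classical
  simp only [content, Finsupp.finsetSum_apply, Finsupp.single_apply]
  rw [Finset.sum_comm, Finset.card_filter]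
  refine Finset.sum_congr rfl fun c _ => ?_
  rw [Finset.sum_ite_eq]
  simp

theorem row_le_entry {μ : YoungDiagram} (T : SemistandardYoungTableau μ) (i j : ℕ)
    (h : (i, j) ∈ μ) : i ≤ T i j := by
  induction i with
  | zero => exact Nat.zero_le _
  | succ i ih =>
    have h1 := ih (μ.up_left_mem (Nat.le_succ i) le_rfl h)
    exact Nat.succ_le_of_lt (lt_of_le_of_lt h1 (T.col_strict (Nat.lt_succ_self i) h))

theorem sum_content_highestWeight (μ : YoungDiagram) (k : ℕ) :
    ∑ v ∈ Finset.range k, content (SemistandardYoungTableau.highestWeight μ) v = topCells μ k := by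
  rw [sum_content, topCells]
  congr 1
  refine Finset.filter_congr fun c hc => ?_
  rw [SemistandardYoungTableau.highestWeight_apply, if_pos ((YoungDiagram.mem_cells _).1 hc)]

theorem topCells_le_of_content {μ ν : YoungDiagram} (T : SemistandardYoungTableau μ)
    (h : content T = content (SemistandardYoungTableau.highestWeight ν)) :
    topCells ν ≤ topCells μ := by
  intro k
  rw [← sum_content_highestWeight, ← h, sum_content, topCells]
  refine Finset.card_le_card fun c hc => ?_
  rw [Finset.mem_filter] at hc ⊢
  exact ⟨hc.1, lt_of_le_of_lt (row_le_entry T c.1 c.2 ((YoungDiagram.mem_cells _).1 hc.1)) hc.2⟩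

theorem finite_content (μ : YoungDiagram) (m : ℕ →₀ ℕ) :
    Finite {T : SemistandardYoungTableau μ // content T = m} := by
  classical
  let f : {T : SemistandardYoungTableau μ // content T = m} → (μ.cells → m.support) :=
    fun T c => ⟨T.1 c.1.1 c.1.2, by
      have h1 : Finsupp.single (T.1 c.1.1 c.1.2) 1 ≤ content T.1 :=
        Finset.single_le_sum (f := fun c : ℕ × ℕ => Finsupp.single (T.1 c.1 c.2) 1)
          (fun _ _ => bot_le) c.2
      have h2 := h1 (T.1 c.1.1 c.1.2)
      rw [Finsupp.single_eq_same, T.2] at h2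
      rw [Finsupp.mem_support_iff]
      omega⟩
  refine Finite.of_injective f fun T U h => Subtype.ext (SemistandardYoungTableau.ext fun i j => ?_)
  by_cases hc : (i, j) ∈ μ
  · exact congrArg Subtype.val (congrFun h ⟨(i, j), (YoungDiagram.mem_cells _).2 hc⟩)
  · rw [T.1.zeros hc, U.1.zeros hc]

/-- The Schur functions are linearly independent (Kostka numbers are unitriangular). -/
theorem linearIndependent_schur : LinearIndependent ℚ schur := by
  classical
  rw [linearIndependent_iff]
  intro l hl
  by_contra hne
  obtain ⟨ν, hν, hmax⟩ := l.support.exists_maximalFor topCells (Finsupp.support_nonempty_iff.2 hne)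
  have h0 : MvPowerSeries.coeff (content (SemistandardYoungTableau.highestWeight ν))
      (Finsupp.linearCombination ℚ schur l) = 0 := by rw [hl, map_zero]
  rw [Finsupp.linearCombination_apply, Finsupp.sum, map_sum] at h0
  rw [Finset.sum_eq_single_of_mem ν hν] at h0
  · have h1 : l ν ≠ 0 := Finsupp.mem_support_iff.1 hν
    have := finite_content ν (content (SemistandardYoungTableau.highestWeight ν))
    have : Nonempty {T : SemistandardYoungTableau ν //
        content T = content (SemistandardYoungTableau.highestWeight ν)} := ⟨⟨_, rfl⟩⟩
    have h2 : (Nat.card {T : SemistandardYoungTableau ν //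
        content T = content (SemistandardYoungTableau.highestWeight ν)} : ℚ) ≠ 0 :=
      Nat.cast_ne_zero.2 Nat.card_pos.ne'
    exact mul_ne_zero h1 h2 h0
  · intro μ hμ hμν
    have hz : schur μ (content (SemistandardYoungTableau.highestWeight ν)) = 0 := by
      have : IsEmpty {T : SemistandardYoungTableau μ //
          content T = content (SemistandardYoungTableau.highestWeight ν)} := by
        refine ⟨fun T => hμν ?_⟩
        have h1 := topCells_le_of_content T.1 T.2
        exact topCells_injective (le_antisymm (hmax hμ h1) h1)
      simp [schur]
    change l μ * schur μ _ = 0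
    rw [hz, mul_zero]

/-- The Schur basis of `Λ`. -/
def schurBasis : Module.Basis YoungDiagram ℚ Lam := Module.Basis.span linearIndependent_schur

/-- The omega involution: the linear map `Λ → Λ` with `ω(s_μ) = s_{μ'}`. -/
def omega : Lam →ₗ[ℚ] Lam := schurBasis.constr ℚ fun μ => schurBasis μ.transpose

theorem coe_schurBasis (μ : YoungDiagram) : (schurBasis μ : MvPowerSeries ℕ ℚ) = schur μ :=
  congrArg Subtype.val (Module.Basis.span_apply linearIndependent_schur μ)

theorem omega_schurBasis (μ : YoungDiagram) : omega (schurBasis μ) = schurBasis μ.transpose :=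
  schurBasis.constr_basis ℚ _ μ

/-! ### Representations of the symmetric group: Specht modules and the Frobenius image -/

theorem finite_partitions (n : ℕ) : {μ : YoungDiagram | μ.card = n}.Finite := by
  classical
  have hsub : ∀ μ : YoungDiagram, μ.card = n →
      μ.cells ∈ (Finset.range n ×ˢ Finset.range n).powerset := by
    intro μ hμ
    rw [Finset.mem_powerset]
    rintro ⟨i, j⟩ hc
    have hc' : (i, j) ∈ μ := (YoungDiagram.mem_cells _).1 hc
    have h1 : (μ.row i).card ≤ n := hμ ▸ Finset.card_le_card (Finset.filter_subset _ _)
    have h2 : (μ.col j).card ≤ n := hμ ▸ Finset.card_le_card (Finset.filter_subset _ _)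
    rw [← YoungDiagram.rowLen_eq_card] at h1
    rw [← YoungDiagram.colLen_eq_card] at h2
    have h3 := YoungDiagram.mem_iff_lt_rowLen.1 hc'
    have h4 := YoungDiagram.mem_iff_lt_colLen.1 hc'
    rw [Finset.mem_product, Finset.mem_range, Finset.mem_range]
    exact ⟨by omega, by omega⟩
  refine Set.Finite.of_finite_image (f := YoungDiagram.cells) ?_
    (fun μ _ ν _ h => YoungDiagram.ext h)
  refine ((Finset.range n ×ˢ Finset.range n).powerset.finite_toSet).subset ?_
  rintro _ ⟨μ, hμ, rfl⟩
  exact hsub μ hμ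

/-- The finite set of partitions of `n`, as Young diagrams. -/
def partitionsOf (n : ℕ) : Finset YoungDiagram := (finite_partitions n).toFinset

/-- The group algebra `ℚ[𝔖ₙ]`. -/
abbrev GroupAlg (n : ℕ) := MonoidAlgebra ℚ (Equiv.Perm (Fin n))

/-- The Young symmetrizer of a bijective filling `T` of the cells of `μ` by `Fin n`:
the product `(∑ σ) (∑ sign(τ) τ)`, where `σ` runs over the permutations preserving every row of `T`
and `τ` over those preserving every column of `T`. -/
def youngSymmetrizer {n : ℕ} {μ : YoungDiagram} (T : μ.cells ≃ Fin n) : GroupAlg n :=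
  (∑ σ : Equiv.Perm (Fin n) with ∀ i, (T.symm (σ i)).1.1 = (T.symm i).1.1,
      MonoidAlgebra.single σ 1) *
  (∑ τ : Equiv.Perm (Fin n) with ∀ i, (T.symm (τ i)).1.2 = (T.symm i).1.2,
      MonoidAlgebra.single τ ((Equiv.Perm.sign τ : ℤ) : ℚ))

/-- The underlying space of the irreducible representation `S^μ` attached to a filling of `μ`: the
left ideal of `ℚ[𝔖ₙ]` generated by the Young symmetrizer. -/
def spechtIdeal {n : ℕ} {μ : YoungDiagram} (T : μ.cells ≃ Fin n) :
    Submodule (GroupAlg n) (GroupAlg n) :=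
  Submodule.span (GroupAlg n) {youngSymmetrizer T}

/-- The irreducible representation `S^μ` of `𝔖ₙ`, by left multiplication on the left ideal. -/
def specht {n : ℕ} {μ : YoungDiagram} (T : μ.cells ≃ Fin n) :
    Representation ℚ (Equiv.Perm (Fin n)) (spechtIdeal T) :=
  Representation.ofModule' (spechtIdeal T)

/-- The multiplicity of `S^μ` in a finite-dimensional representation `ρ` of `𝔖ₙ`, that is
`dim Hom_{𝔖ₙ}(S^μ, ρ)`.  (Up to isomorphism `S^μ` does not depend on the filling chosen; the value is
`0` if `μ` is not a partition of `n`.) -/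
def multiplicity {n : ℕ} {M : Type*} [AddCommGroup M] [Module ℚ M]
    (ρ : Representation ℚ (Equiv.Perm (Fin n)) M) (μ : YoungDiagram) : ℕ :=
  if h : μ.cells.card = n then
    Module.finrank ℚ (Representation.IntertwiningMap (specht (μ.cells.equivFinOfCardEq h)) ρ)
  else 0

/-- The Frobenius image `Frob(ρ) = ∑_{μ ⊢ n} m_μ s_μ`. -/
def frob {n : ℕ} {M : Type*} [AddCommGroup M] [Module ℚ M]
    (ρ : Representation ℚ (Equiv.Perm (Fin n)) M) : Lam :=
  ∑ μ ∈ partitionsOf n, (multiplicity ρ μ : ℚ) • schurBasis μ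

/-- The graded Frobenius image `∑_d Frob(M_d) q^d` of a graded representation with graded pieces
`𝒜 d`, recorded as the sequence of its coefficients. -/
def grFrob {n : ℕ} {M : Type*} [AddCommGroup M] [Module ℚ M]
    {ρ : Representation ℚ (Equiv.Perm (Fin n)) M}
    (𝒜 : ℕ → Subrepresentation ρ) : ℕ → Lam :=
  fun d => frob (𝒜 d).toRepresentation

/-- The degree in `q` of a polynomial in `q` given by its sequence of coefficients. -/
def qDegree (F : ℕ → Lam) : ℕ := sSup {d | F d ≠ 0}

/-- The `q`-reversal `q^d F(q⁻¹)`, `d = deg F`, of a polynomial in `q` given by its coefficients. -/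
def revq (F : ℕ → Lam) : ℕ → Lam := fun i => if i ≤ qDegree F then F (qDegree F - i) else 0

/-! ### Superspace -/

/-- Superspace `ℚ[x₁,…,xₙ, θ₁,…,θₙ]`, in its model `Sym ⊗ ⋀`: commuting `x`-variables which
commute with the anticommuting `θ`-variables. -/
abbrev Superspace (n : ℕ) := MvPolynomial (Fin n) ℚ ⊗[ℚ] ExteriorAlgebra ℚ (Fin n →₀ ℚ)

/-- A polynomial in the `x`-variables as an element of superspace. -/
def ofPoly {n : ℕ} (f : MvPolynomial (Fin n) ℚ) : Superspace n := f ⊗ₜ 1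

/-- The anticommuting variable `θᵢ`. -/
def theta {n : ℕ} (i : Fin n) : Superspace n :=
  1 ⊗ₜ ExteriorAlgebra.ι ℚ (Finsupp.single i 1)

/-- The diagonal action of a permutation: `w · xᵢ = x_{w(i)}`, `w · θᵢ = θ_{w(i)}`. -/
def permHom {n : ℕ} (w : Equiv.Perm (Fin n)) : Superspace n →ₐ[ℚ] Superspace n :=
  Algebra.TensorProduct.map (rename w) (ExteriorAlgebra.map (Finsupp.lmapDomain ℚ ℚ w))

theorem permHom_mul {n : ℕ} (v w : Equiv.Perm (Fin n)) :
    permHom (v * w) = (permHom v).comp (permHom w) := by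
  apply Algebra.TensorProduct.ext
  · ext i; simp [permHom]
  · ext i; simp [permHom]

theorem permHom_one {n : ℕ} : permHom (1 : Equiv.Perm (Fin n)) = AlgHom.id ℚ _ := by
  apply Algebra.TensorProduct.ext
  · ext i; simp [permHom]
  · ext i; simp [permHom]

/-- Superspace as a representation of `𝔖ₙ`. -/
def superRep (n : ℕ) : Representation ℚ (Equiv.Perm (Fin n)) (Superspace n) where
  toFun w := (permHom w).toLinearMap
  map_one' := by rw [permHom_one]; rfl
  map_mul' v w := by rw [permHom_mul]; rfl

/-- Partial differentiation with respect to `xᵢ`, the `θ`-variables being constants. -/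
def pd {n : ℕ} (i : Fin n) : Module.End ℚ (Superspace n) :=
  LinearMap.rTensor _ (pderiv i : Derivation ℚ (MvPolynomial (Fin n) ℚ) _).toLinearMap

/-- The superpolynomials that are `x`-homogeneous of `x`-degree `d`. -/
def xHomogeneous (n d : ℕ) : Submodule ℚ (Superspace n) :=
  LinearMap.range
    (LinearMap.rTensor (ExteriorAlgebra ℚ (Fin n →₀ ℚ)) (homogeneousSubmodule (Fin n) ℚ d).subtype)

/-! ### The superspace Vandermonde and the module it generates -/

/-- The operator `εₙ = ∑_w sign(w) w`. -/
def antisymmetrize {n : ℕ} (f : Superspace n) : Superspace n :=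
  ∑ w : Equiv.Perm (Fin n), ((Equiv.Perm.sign w : ℤ) : ℚ) • superRep n w f

/-- For `a = (a₁,…,a_r)` and `n = r + k`, the superspace Vandermonde
`Δₙ(a) = εₙ · (x₁^{a₁} ⋯ x_r^{a_r} x_{r+1}^{k-1} x_{r+2}^{k-2} ⋯ x_n^0 · θ₁ θ₂ ⋯ θ_r)`. -/
def vandermonde {r : ℕ} (k : ℕ) (a : Fin r → ℕ) : Superspace (r + k) :=
  antisymmetrize
    (ofPoly (∏ i, X i ^ (Fin.append a (fun j : Fin k => k - 1 - (j : ℕ)) i)) *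
      (List.ofFn fun j : Fin r => theta (Fin.castAdd k j)).prod)

/-- The smallest subspace containing `g` and closed under all partial derivatives `∂ᵢ`. -/
def cone {n : ℕ} (g : Superspace n) : Submodule ℚ (Superspace n) :=
  sInf {W | g ∈ W ∧ ∀ i, ∀ f ∈ W, pd i f ∈ W}

theorem superRep_pd {n : ℕ} (w : Equiv.Perm (Fin n)) (i : Fin n) (f : Superspace n) :
    superRep n w (pd i f) = pd (w i) (superRep n w f) := by
  induction f using TensorProduct.induction_on with
  | zero => simp
  | tmul p q =>
    change permHom w (pderiv i p ⊗ₜ q) = pd (w i) (permHom w (p ⊗ₜ q))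
    simp only [permHom, Algebra.TensorProduct.map_tmul, pd, LinearMap.rTensor_tmul]
    congr 1
    exact (pderiv_rename w.injective i p).symm
  | add f g hf hg => simp only [map_add, hf, hg]

theorem superRep_antisymmetrize {n : ℕ} (w : Equiv.Perm (Fin n)) (f : Superspace n) :
    superRep n w (antisymmetrize f) = ((Equiv.Perm.sign w : ℤ) : ℚ) • antisymmetrize f := by
  simp only [antisymmetrize, map_sum, map_smul, Finset.smul_sum]
  refine Fintype.sum_equiv (Equiv.mulLeft w) _ _ fun v => ?_
  change _ • superRep n w (superRep n v f) =
    ((Equiv.Perm.sign w : ℤ) : ℚ) • ((Equiv.Perm.sign (w * v) : ℤ) : ℚ) • superRep n (w * v) f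
  rw [map_mul (superRep n), smul_smul, Equiv.Perm.sign_mul, ← Int.cast_mul, ← Units.val_mul, ← mul_assoc,
    Int.units_mul_self, one_mul]
  rfl

theorem superRep_cone {n : ℕ} (g : Superspace n) (w : Equiv.Perm (Fin n)) :
    ∀ f ∈ cone (antisymmetrize g), superRep n w f ∈ cone (antisymmetrize g) := by
  have h : cone (antisymmetrize g) ≤ (cone (antisymmetrize g)).comap (superRep n w) := by
    refine sInf_le ⟨?_, fun i f hf => ?_⟩
    · rw [Submodule.mem_comap, superRep_antisymmetrize]
      exact Submodule.smul_mem _ _ (Submodule.mem_sInf.2 fun W hW => hW.1)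
    · rw [Submodule.mem_comap, superRep_pd]
      rw [Submodule.mem_comap] at hf
      exact Submodule.mem_sInf.2 fun W hW => hW.2 _ _ (Submodule.mem_sInf.1 hf W hW)
  exact h

theorem superRep_xHomogeneous {n d : ℕ} (w : Equiv.Perm (Fin n)) :
    ∀ f ∈ xHomogeneous n d, superRep n w f ∈ xHomogeneous n d := by
  rintro _ ⟨t, rfl⟩
  induction t using TensorProduct.induction_on with
  | zero => simp
  | tmul p q =>
    refine ⟨(⟨rename w p.1, ?_⟩ : homogeneousSubmodule (Fin n) ℚ d) ⊗ₜ
      ExteriorAlgebra.map (Finsupp.lmapDomain ℚ ℚ w) q, rfl⟩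
    exact IsHomogeneous.rename_isHomogeneous p.2
  | add s t hs ht => rw [map_add, map_add]; exact Submodule.add_mem _ hs ht

/-- The `𝔖ₙ`-module `Vₙ(a)`: the smallest subspace of superspace that contains `Δₙ(a)` and is closed
under the operators `∂ᵢ`, with the action of `𝔖ₙ` restricted from superspace. -/
def vanderModule {r : ℕ} (k : ℕ) (a : Fin r → ℕ) : Subrepresentation (superRep (r + k)) where
  toSubmodule := cone (vandermonde k a)
  apply_mem_toSubmodule w f hf := superRep_cone _ w f hf

/-- The graded pieces of `Vₙ(a)` with respect to `x`-degree. -/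
def vanderPiece {r : ℕ} (k : ℕ) (a : Fin r → ℕ) (d : ℕ) :
    Subrepresentation (superRep (r + k)) where
  toSubmodule := cone (vandermonde k a) ⊓ xHomogeneous (r + k) d
  apply_mem_toSubmodule w f hf :=
    ⟨superRep_cone _ w f hf.1, superRep_xHomogeneous w f hf.2⟩

/-- The operator `∂(f)` obtained from a polynomial `f` by replacing each `xᵢ` by `∂ᵢ`. -/
def diffOp {n : ℕ} (f : MvPolynomial (Fin n) ℚ) : Module.End ℚ (Superspace n) :=
  ∑ m ∈ f.support, f.coeff m • (List.ofFn fun i => pd i ^ m i).prod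

/-! ### The quotient rings `R_{n,k,s}` -/

/-- The ideal `I_{n,k,s} = ⟨x₁^s, …, xₙ^s, eₙ, e_{n-1}, …, e_{n-k+1}⟩` of `ℚ[x₁,…,xₙ]`. -/
def idealI (n k s : ℕ) : Ideal (MvPolynomial (Fin n) ℚ) :=
  Ideal.span (Set.range (fun i => X i ^ s) ∪ {f | ∃ d, n < d + k ∧ d ≤ n ∧ f = esymm (Fin n) ℚ d})

/-- The quotient ring `R_{n,k,s}`. -/
abbrev RingR (n k s : ℕ) := MvPolynomial (Fin n) ℚ ⧸ idealI n k s

theorem idealI_le_comap (n k s : ℕ) (w : Equiv.Perm (Fin n)) :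
    idealI n k s ≤ (idealI n k s).comap (rename w : _ →ₐ[ℚ] MvPolynomial (Fin n) ℚ) := by
  refine Ideal.span_le.2 ?_
  rintro _ (⟨i, rfl⟩ | ⟨d, h1, h2, rfl⟩)
  · change rename w (X i ^ s) ∈ idealI n k s
    rw [map_pow, rename_X]
    exact Ideal.subset_span (Or.inl ⟨w i, rfl⟩)
  · change rename w (esymm (Fin n) ℚ d) ∈ idealI n k s
    rw [rename_esymm]
    exact Ideal.subset_span (Or.inr ⟨d, h1, h2, rfl⟩)

/-- `R_{n,k,s}` as a representation of `𝔖ₙ`, with `w · xᵢ = x_{w(i)}`. -/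
def ringRep (n k s : ℕ) : Representation ℚ (Equiv.Perm (Fin n)) (RingR n k s) where
  toFun w := (Ideal.quotientMapₐ (idealI n k s) (rename w) (idealI_le_comap n k s w)).toLinearMap
  map_one' := by
    refine LinearMap.ext fun f => ?_
    obtain ⟨p, rfl⟩ := Ideal.Quotient.mk_surjective f
    change Ideal.Quotient.mk _ (rename (id : Fin n → Fin n) p) = Ideal.Quotient.mk _ p
    rw [rename_id_apply]
  map_mul' v w := by
    refine LinearMap.ext fun f => ?_
    obtain ⟨p, rfl⟩ := Ideal.Quotient.mk_surjective f
    change Ideal.Quotient.mk _ (rename (v ∘ w) p) = Ideal.Quotient.mk _ (rename v (rename w p))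
    rw [rename_rename]

/-- The graded pieces of `R_{n,k,s}`: the images of the homogeneous polynomials of degree `d`. -/
def ringPiece (n k s d : ℕ) : Subrepresentation (ringRep n k s) where
  toSubmodule :=
    (homogeneousSubmodule (Fin n) ℚ d).map (Ideal.Quotient.mkₐ ℚ (idealI n k s)).toLinearMap
  apply_mem_toSubmodule := by
    rintro w _ ⟨p, hp, rfl⟩
    exact ⟨rename w p, IsHomogeneous.rename_isHomogeneous hp, rfl⟩

end SuperVandermonde

end

/-!
# The annihilator and the graded Frobenius image of a superspace Vandermonde

Write `Δ` for the superspace Vandermonde with `a = (s - 1, …, s - 1)`, where `n = r + k`. Its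
coefficient at a monomial in the `θ`-variables is, up to a nonzero scalar, the product of the
`x_i ^ (s - 1)` over the indices `i` of the `θ`s and of the ordinary Vandermonde determinant in the
other `k` variables (`exists_contract_eq_block`).

*The annihilator* (`mem_idealI_iff`). All exponents in `Δ` are less than `s`, so `∂ᵢ ^ s` kills `Δ`.
For `d > r` the operator `e_d(∂)` commutes with antisymmetrization, and each of its terms
differentiates with respect to a variable without a `θ`; as the exponents of these variables are
consecutive, the result has a repeated exponent or is zero, and its antisymmetrization vanishes.
Conversely, if `f(∂) Δ = 0`, then every multiple of `f` is apolar to all the components of `Δ`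
(`KillsBlocks`). That such an `f` lies in the ideal is shown by induction on `n`. Write
`f = x₀ ^ j (g + x₀ h)` with `g` free of `x₀`. Pairing against the components in which `x₀` occurs
in the Vandermonde factor, or as `x₀ ^ (s - 1)`, shows that `g` annihilates the components for
`(n - 1, k - 1, s)` if `j < k`, and for `(n - 1, k, s)` if `j < s`. By induction `g` lies in the
corresponding ideal, and `x₀ ^ j g` can be lifted to the ideal for `(n, k, s)` up to a multiple of
`x₀ ^ (j + 1)`. After subtracting the lift `j` increases, and `x₀ ^ s` lies in the ideal.

*The Frobenius image* (`grFrob_vanderPiece`). Hence `f ↦ f(∂) Δ` is a linear isomorphism of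
`R_{n,k,s}` with `Vₙ(a)`. It sends degree `d` to degree `deg Δ - d`, and as `w Δ = sign(w) Δ`, it
twists the action by the sign (`exists_pieceEquiv`). On Frobenius images a sign twist is `ω`
(`omega_frob`), because `S^{μ'}` is the sign twist of `S^μ` (`exists_spechtEquiv`), a consequence of
the positivity of `x x*` in the rational group algebra. It remains to see that the degree in `q`
used for the reversal is `deg Δ`, although the graded Frobenius image only records multiplicities:
`Vₙ(a)` has nonzero elements of degree `0`, and a nonzero representation has a nonzero Frobenius
image (`frob_ne_zero`). The latter holds because the central elements `∑ g c g⁻¹`, `c` a Young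
symmetrizer, one for each diagram, are linearly independent and as many as the conjugacy classes, so
that they span the centre of the group algebra, and some Young symmetrizer acts by a nonzero
operator.
-/

noncomputable section

namespace SuperVandermonde

/-! ### Constant coefficient differential operators -/

theorem pd_comm {n : ℕ} (i j : Fin n) : pd i * pd j = pd j * pd i := by
  refine TensorProduct.ext' fun p q => ?_
  change pderiv i (pderiv j p) ⊗ₜ q = pderiv j (pderiv i p) ⊗ₜ[ℚ] q
  congr 1
  ext m
  simp only [coeff_pderiv, add_right_comm m (Finsupp.single i 1), Finsupp.add_apply]
  rcases eq_or_ne i j with rfl | h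
  · rfl
  · rw [Finsupp.single_eq_of_ne h, Finsupp.single_eq_of_ne h.symm]
    push_cast
    ring

/-- The commutative algebra of operators generated by the `∂ᵢ`. -/
abbrev pdAlgebra (n : ℕ) : Subalgebra ℚ (Module.End ℚ (Superspace n)) :=
  Algebra.adjoin ℚ (Set.range pd)

instance (n : ℕ) : IsMulCommutative (pdAlgebra n) :=
  Algebra.isMulCommutative_adjoin ℚ (by
    rintro _ ⟨i, rfl⟩ _ ⟨j, rfl⟩
    exact pd_comm i j)

open scoped IsMulCommutative in
/-- The substitution `f ↦ f(∂₁, …, ∂ₙ)` as an algebra homomorphism. -/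
def diffHom (n : ℕ) : MvPolynomial (Fin n) ℚ →ₐ[ℚ] Module.End ℚ (Superspace n) :=
  (pdAlgebra n).val.comp (aeval (R := ℚ) (S₁ := pdAlgebra n)
    fun i => ⟨pd i, Algebra.subset_adjoin ⟨i, rfl⟩⟩)

open scoped IsMulCommutative in
@[simp]
theorem diffHom_X {n : ℕ} (i : Fin n) : diffHom n (X i) = pd i := by
  simp [diffHom]

open scoped IsMulCommutative in
theorem diffHom_prod {n : ℕ} (m : Fin n → ℕ) :
    diffHom n (∏ i, X i ^ m i) = (List.ofFn fun i => pd i ^ m i).prod := by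
  rw [← List.prod_ofFn, map_list_prod, List.map_ofFn]
  congr 2
  ext1 i
  simp

theorem diffOp_eq {n : ℕ} (f : MvPolynomial (Fin n) ℚ) : diffOp f = diffHom n f := by
  conv_rhs => rw [f.as_sum, map_sum]
  refine Finset.sum_congr rfl fun m _ => ?_
  rw [← diffHom_prod, ← map_smul]
  congr 1
  rw [monomial_eq, smul_eq_C_mul, Finsupp.prod_fintype _ _ (by simp)]

theorem superRep_diffHom {n : ℕ} (w : Equiv.Perm (Fin n)) (f : MvPolynomial (Fin n) ℚ)
    (t : Superspace n) :
    superRep n w (diffHom n f t) = diffHom n (rename w f) (superRep n w t) := by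
  induction f using MvPolynomial.induction_on generalizing t with
  | C c =>
    rw [rename_C, ← algebraMap_eq, AlgHom.commutes]
    exact map_smul (superRep n w) c t
  | add f g hf hg => simp only [map_add, LinearMap.add_apply, hf, hg]
  | mul_X f i hf =>
    simp only [map_mul, rename_X, diffHom_X, Module.End.mul_apply, hf, superRep_pd]

/-! ### Apolarity: the pairing `⟨x^a, x^b⟩ = a! δ_{ab}` -/

/-- Apply a linear functional to the `θ`-part of a superpolynomial. -/
def contract {n : ℕ} (φ : ExteriorAlgebra ℚ (Fin n →₀ ℚ) →ₗ[ℚ] ℚ) :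
    Superspace n →ₗ[ℚ] MvPolynomial (Fin n) ℚ :=
  (TensorProduct.rid ℚ _).toLinearMap ∘ₗ LinearMap.lTensor _ φ

@[simp]
theorem contract_tmul {n : ℕ} (φ : ExteriorAlgebra ℚ (Fin n →₀ ℚ) →ₗ[ℚ] ℚ)
    (p : MvPolynomial (Fin n) ℚ) (q : ExteriorAlgebra ℚ (Fin n →₀ ℚ)) :
    contract φ (p ⊗ₜ q) = φ q • p := by
  simp [contract]

theorem contract_pd {n : ℕ} (φ : ExteriorAlgebra ℚ (Fin n →₀ ℚ) →ₗ[ℚ] ℚ) (i : Fin n)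
    (t : Superspace n) : contract φ (pd i t) = pderiv i (contract φ t) := by
  induction t using TensorProduct.induction_on with
  | zero => simp
  | tmul p q =>
    change contract φ (pderiv i p ⊗ₜ q) = _
    rw [contract_tmul, contract_tmul, Derivation.map_smul]
  | add s t hs ht => simp only [map_add, hs, ht]

/-- The product `m! = ∏ mᵢ!` of the factorials of an exponent vector. -/
def factorial {n : ℕ} (m : Fin n →₀ ℕ) : ℚ := ∏ i, ((m i).factorial : ℚ)

theorem factorial_ne_zero {n : ℕ} (m : Fin n →₀ ℕ) : factorial m ≠ 0 :=
  Finset.prod_ne_zero_iff.2 fun i _ => Nat.cast_ne_zero.2 (m i).factorial_ne_zero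

theorem factorial_add_single {n : ℕ} (m : Fin n →₀ ℕ) (i : Fin n) :
    factorial (m + Finsupp.single i 1) = factorial m * (m i + 1) := by
  rw [factorial, factorial, ← Finset.mul_prod_erase _ _ (Finset.mem_univ i),
    ← Finset.mul_prod_erase _ (fun i => ((m i).factorial : ℚ)) (Finset.mem_univ i)]
  have : ∀ j ∈ Finset.univ.erase i,
      (((m + Finsupp.single i 1 : Fin n →₀ ℕ) j).factorial : ℚ) = ((m j).factorial : ℚ) := by
    intro j hj
    rw [Finsupp.add_apply, Finsupp.single_eq_of_ne (Finset.ne_of_mem_erase hj), add_zero]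
  rw [Finset.prod_congr rfl this, Finsupp.add_apply, Finsupp.single_eq_same, Nat.factorial_succ]
  push_cast
  ring

/-- The apolar pairing `f ↦ ⟨f, p⟩`, the value at `0` of `f(∂) p`, described by
`⟨x^a, x^b⟩ = a! δ_{ab}`. -/
def pair {n : ℕ} (p : MvPolynomial (Fin n) ℚ) : MvPolynomial (Fin n) ℚ →ₗ[ℚ] ℚ :=
  (basisMonomials (Fin n) ℚ).constr ℚ fun m => factorial m * coeff m p

theorem pair_monomial {n : ℕ} (p : MvPolynomial (Fin n) ℚ) (m : Fin n →₀ ℕ) :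
    pair p (monomial m 1) = factorial m * coeff m p := by
  have h := (basisMonomials (Fin n) ℚ).constr_basis ℚ (fun m => factorial m * coeff m p) m
  rwa [coe_basisMonomials] at h

theorem pair_mul_X {n : ℕ} (p f : MvPolynomial (Fin n) ℚ) (i : Fin n) :
    pair p (f * X i) = pair (pderiv i p) f := by
  suffices h : pair p ∘ₗ LinearMap.mulRight ℚ (X i) = pair (pderiv i p) from LinearMap.congr_fun h f
  refine (basisMonomials (Fin n) ℚ).ext fun m => ?_
  rw [coe_basisMonomials, LinearMap.comp_apply, LinearMap.mulRight_apply, X, monomial_mul, one_mul,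
    pair_monomial, pair_monomial, factorial_add_single, coeff_pderiv]
  ring

/-- The constant term of `f(∂) t` is given by the apolar pairing. -/
theorem coeff_zero_contract_diffHom {n : ℕ} (φ : ExteriorAlgebra ℚ (Fin n →₀ ℚ) →ₗ[ℚ] ℚ)
    (f : MvPolynomial (Fin n) ℚ) (t : Superspace n) :
    coeff 0 (contract φ (diffHom n f t)) = pair (contract φ t) f := by
  induction f using MvPolynomial.induction_on generalizing t with
  | C c =>
    rw [← algebraMap_eq, AlgHom.commutes, Module.algebraMap_end_apply, map_smul, coeff_smul,
      Algebra.algebraMap_eq_smul_one, map_smul, ← C_1, ← monomial_zero', pair_monomial]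
    simp [factorial]
  | add f g hf hg => simp only [map_add, LinearMap.add_apply, coeff_add, hf, hg]
  | mul_X f i hf =>
    rw [map_mul, diffHom_X, Module.End.mul_apply, hf, contract_pd, pair_mul_X]

/-! ### Splitting off one variable: the apolar pairing -/

theorem factorial_cons {n : ℕ} (e : ℕ) (m : Fin n →₀ ℕ) :
    factorial (Finsupp.cons e m) = (e.factorial : ℚ) * factorial m := by
  rw [factorial, Fin.prod_univ_succ, Finsupp.cons_zero]
  simp only [Finsupp.cons_succ]
  rfl

theorem X_zero_pow_mul_rename_monomial {n : ℕ} (e : ℕ) (m : Fin n →₀ ℕ) :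
    X 0 ^ e * rename Fin.succ (monomial m 1) =
      (monomial (Finsupp.cons e m) 1 : MvPolynomial (Fin (n + 1)) ℚ) := by
  rw [monomial_eq, monomial_eq, Finsupp.prod_fintype _ _ (by simp),
    Finsupp.prod_fintype _ _ (by simp), Fin.prod_univ_succ]
  simp [map_prod]

/-- Pairing with the top coefficient in the variable `x₀`. -/
theorem pair_X_zero_pow_mul_rename {n : ℕ} (p : MvPolynomial (Fin (n + 1)) ℚ) (e : ℕ)
    (g : MvPolynomial (Fin n) ℚ) :
    pair p (X 0 ^ e * rename Fin.succ g) =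
      (e.factorial : ℚ) * pair ((finSuccEquiv ℚ n p).coeff e) g := by
  suffices h : pair p ∘ₗ LinearMap.mulLeft ℚ (X 0 ^ e) ∘ₗ (rename Fin.succ).toLinearMap =
      (e.factorial : ℚ) • pair ((finSuccEquiv ℚ n p).coeff e) by
    have h1 := LinearMap.congr_fun h g
    rwa [LinearMap.comp_apply, LinearMap.comp_apply, LinearMap.mulLeft_apply,
      AlgHom.toLinearMap_apply, LinearMap.smul_apply, smul_eq_mul] at h1
  refine (basisMonomials (Fin n) ℚ).ext fun m => ?_
  rw [coe_basisMonomials, LinearMap.comp_apply, LinearMap.comp_apply, LinearMap.mulLeft_apply,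
    AlgHom.toLinearMap_apply, LinearMap.smul_apply, smul_eq_mul]
  rw [X_zero_pow_mul_rename_monomial, pair_monomial, pair_monomial, factorial_cons,
    finSuccEquiv_coeff_coeff, mul_assoc]

/-- The apolar pairing with `p` vanishes on multiples of `x₀ ^ e` when `e` exceeds the `x₀`-degree
of `p`. -/
theorem pair_X_zero_pow_mul_eq_zero {n : ℕ} (p h : MvPolynomial (Fin (n + 1)) ℚ) {e : ℕ}
    (he : (finSuccEquiv ℚ n p).natDegree < e) : pair p (X 0 ^ e * h) = 0 := by
  suffices h0 : pair p ∘ₗ LinearMap.mulLeft ℚ (X 0 ^ e) = 0 by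
    have h1 := LinearMap.congr_fun h0 h
    rwa [LinearMap.comp_apply, LinearMap.mulLeft_apply, LinearMap.zero_apply] at h1
  refine (basisMonomials (Fin (n + 1)) ℚ).ext fun m => ?_
  rw [coe_basisMonomials, LinearMap.comp_apply, LinearMap.mulLeft_apply, LinearMap.zero_apply]
  obtain ⟨i, m, rfl⟩ : ∃ i m', m = Finsupp.cons i m' :=
    ⟨m 0, Finsupp.tail m, (Finsupp.cons_tail m).symm⟩
  beta_reduce
  rw [← X_zero_pow_mul_rename_monomial, ← mul_assoc, ← pow_add, pair_X_zero_pow_mul_rename,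
    Polynomial.coeff_eq_zero_of_natDegree_lt (by omega)]
  have : pair (0 : MvPolynomial (Fin n) ℚ) (monomial m 1) = 0 := by simp [pair_monomial]
  rw [this, mul_zero]

/-! ### The components of the superspace Vandermonde -/

/-- For `v : Fin k → Fin n`, the product of the `x_i ^ (s - 1)` over the `i` outside the range of
`v` and of the Vandermonde product in the variables `x_{v(j)}`. -/
def block (s : ℕ) {n k : ℕ} (v : Fin k → Fin n) : MvPolynomial (Fin n) ℚ :=
  (∏ i, if ∃ j, v j = i then 1 else X i ^ (s - 1)) *
    ∏ i, ∏ j ∈ Finset.Ioi i, (X (v j) - X (v i))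

theorem finSuccEquiv_block_succ (s : ℕ) {n k : ℕ} (v : Fin k → Fin n) :
    finSuccEquiv ℚ n (block s (Fin.succ ∘ v)) =
      Polynomial.C (block s v) * Polynomial.X ^ (s - 1) := by
  rw [block, Fin.prod_univ_succ, if_neg (by simp [Fin.succ_ne_zero])]
  simp only [Function.comp_apply, Fin.succ_inj, map_mul, map_pow, finSuccEquiv_X_zero, map_prod,
    map_sub, finSuccEquiv_X_succ, apply_ite (finSuccEquiv ℚ n), map_one, block,
    apply_ite (Polynomial.C)]
  ring

theorem finSuccEquiv_block_cons (s : ℕ) {n k : ℕ} (v : Fin k → Fin n) :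
    finSuccEquiv ℚ n (block s (Fin.cons 0 (Fin.succ ∘ v) : Fin (k + 1) → Fin (n + 1))) =
      Polynomial.C (block s v) * ∏ j, (Polynomial.C (X (v j)) - Polynomial.X) := by
  have h : ∀ i : Fin n, (∃ j, (Fin.cons 0 (Fin.succ ∘ v) : Fin (k + 1) → Fin (n + 1)) j = i.succ) ↔
      ∃ j, v j = i := fun i => by simp [Fin.exists_fin_succ, (Fin.succ_ne_zero _).symm]
  rw [block, Fin.prod_univ_succ, if_pos ⟨0, rfl⟩, Fin.prod_univ_succ, Fin.prod_Ioi_zero]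
  simp only [h, Fin.prod_Ioi_succ, Fin.cons_succ, Fin.cons_zero, Function.comp_apply, map_mul,
    map_pow, finSuccEquiv_X_zero, map_prod, map_sub, finSuccEquiv_X_succ,
    apply_ite (finSuccEquiv ℚ n), map_one, block, apply_ite (Polynomial.C)]
  ring

theorem natDegree_prod_C_sub_X {R : Type*} [CommRing R] [Nontrivial R] {k : ℕ} (y : Fin k → R) :
    (∏ j, (Polynomial.C (y j) - Polynomial.X)).natDegree ≤ k ∧
      (∏ j, (Polynomial.C (y j) - Polynomial.X)).coeff k = (-1) ^ k := by
  have h : ∀ j, Polynomial.C (y j) - Polynomial.X = -(Polynomial.X - Polynomial.C (y j)) :=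
    fun j => by ring
  simp only [h, Finset.prod_neg]
  have hm := Polynomial.monic_prod_of_monic Finset.univ
    (fun j => Polynomial.X - Polynomial.C (y j)) fun j _ => Polynomial.monic_X_sub_C _
  have hd := Polynomial.natDegree_prod_of_monic Finset.univ
    (fun j => Polynomial.X - Polynomial.C (y j)) fun j _ => Polynomial.monic_X_sub_C _
  simp only [Polynomial.natDegree_X_sub_C, Finset.sum_const, Finset.card_univ, Fintype.card_fin,
    smul_eq_mul, mul_one] at hd
  have hc : ((-1 : Polynomial R)) ^ k = Polynomial.C ((-1) ^ k) := by simp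
  rw [Finset.card_univ, Fintype.card_fin, hc]
  refine ⟨(Polynomial.natDegree_C_mul_le _ _).trans hd.le, ?_⟩
  have hl := hm.coeff_natDegree
  rw [hd] at hl
  rw [Polynomial.coeff_C_mul, hl, mul_one]

/-- `f` annihilates all the components of the superspace Vandermonde for the parameters `n, k, s`.
-/
def KillsBlocks (s n k : ℕ) (f : MvPolynomial (Fin n) ℚ) : Prop :=
  ∀ v : Fin k → Fin n, Function.Injective v → ∀ q, pair (block s v) (q * f) = 0

/-- If `f` is divisible by `x₀ ^ j` with `j < s`, then its leading coefficient annihilates the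
components whose `x₀`-exponent is `s - 1`. -/
theorem KillsBlocks.lead_of_lt {s n k j : ℕ} (hj : j < s) {g : MvPolynomial (Fin n) ℚ}
    {h : MvPolynomial (Fin (n + 1)) ℚ}
    (H : KillsBlocks s (n + 1) k (X 0 ^ j * (rename Fin.succ g + X 0 * h))) :
    KillsBlocks s n k g := by
  intro v hv q
  have h1 := H (Fin.succ ∘ v) ((Fin.succ_injective n).comp hv)
    (X 0 ^ (s - 1 - j) * rename Fin.succ q)
  have h2 : X 0 ^ (s - 1 - j) * rename Fin.succ q * (X 0 ^ j * (rename Fin.succ g + X 0 * h)) =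
      X 0 ^ (s - 1) * rename Fin.succ (q * g) + X 0 ^ s * (rename Fin.succ q * h) := by
    have e1 : (X 0 : MvPolynomial (Fin (n + 1)) ℚ) ^ (s - 1) = X 0 ^ (s - 1 - j) * X 0 ^ j := by
      rw [← pow_add, Nat.sub_add_cancel (by omega)]
    have e2 : (X 0 : MvPolynomial (Fin (n + 1)) ℚ) ^ s = X 0 ^ (s - 1) * X 0 := by
      rw [← pow_succ, Nat.sub_add_cancel (by omega)]
    rw [map_mul, e2, e1]
    ring
  rw [h2, map_add, pair_X_zero_pow_mul_rename, pair_X_zero_pow_mul_eq_zero, add_zero,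
    finSuccEquiv_block_succ, Polynomial.coeff_C_mul, Polynomial.coeff_X_pow_self, mul_one] at h1
  · exact (mul_eq_zero.1 h1).resolve_left (Nat.cast_ne_zero.2 (Nat.factorial_ne_zero _))
  · rw [finSuccEquiv_block_succ]
    exact (Polynomial.natDegree_C_mul_X_pow_le _ _).trans_lt (by omega)

/-- If `f` is divisible by `x₀ ^ j` with `j ≤ k`, then its leading coefficient annihilates the
components whose Vandermonde factor involves `x₀`. -/
theorem KillsBlocks.lead_of_le {s n k j : ℕ} (hj : j ≤ k) {g : MvPolynomial (Fin n) ℚ}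
    {h : MvPolynomial (Fin (n + 1)) ℚ}
    (H : KillsBlocks s (n + 1) (k + 1) (X 0 ^ j * (rename Fin.succ g + X 0 * h))) :
    KillsBlocks s n k g := by
  intro v hv q
  have h1 := H (Fin.cons 0 (Fin.succ ∘ v))
    (Fin.cons_injective_iff.2 ⟨by simp [Fin.succ_ne_zero], (Fin.succ_injective n).comp hv⟩)
    (X 0 ^ (k - j) * rename Fin.succ q)
  have h2 : X 0 ^ (k - j) * rename Fin.succ q * (X 0 ^ j * (rename Fin.succ g + X 0 * h)) =
      X 0 ^ k * rename Fin.succ (q * g) + X 0 ^ (k + 1) * (rename Fin.succ q * h) := by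
    have e1 : (X 0 : MvPolynomial (Fin (n + 1)) ℚ) ^ k = X 0 ^ (k - j) * X 0 ^ j := by
      rw [← pow_add, Nat.sub_add_cancel hj]
    rw [map_mul, pow_succ, e1]
    ring
  have h3 := natDegree_prod_C_sub_X fun j => (X (v j) : MvPolynomial (Fin n) ℚ)
  rw [h2, map_add, pair_X_zero_pow_mul_rename, pair_X_zero_pow_mul_eq_zero, add_zero,
    finSuccEquiv_block_cons, Polynomial.coeff_C_mul, h3.2] at h1
  · have h4 := (mul_eq_zero.1 h1).resolve_left (Nat.cast_ne_zero.2 (Nat.factorial_ne_zero _))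
    rcases neg_one_pow_eq_or (MvPolynomial (Fin n) ℚ) k with hk | hk
    · rwa [hk, mul_one] at h4
    · have : pair (-block s v) = -pair (block s v) := by
        refine (basisMonomials (Fin n) ℚ).ext fun m => ?_
        simp [pair_monomial]
      rwa [hk, mul_neg_one, this, LinearMap.neg_apply, neg_eq_zero] at h4
  · rw [finSuccEquiv_block_cons]
    exact ((Polynomial.natDegree_C_mul_le _ _).trans h3.1).trans_lt (Nat.lt_succ_self k)

/-! ### Splitting off one variable: the ideals -/

theorem esymm_fin_succ (n d : ℕ) :
    esymm (Fin (n + 1)) ℚ (d + 1) =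
      rename Fin.succ (esymm (Fin n) ℚ (d + 1)) + X 0 * rename Fin.succ (esymm (Fin n) ℚ d) := by
  have h : ∀ e, rename Fin.succ (esymm (Fin n) ℚ e) =
      ((Finset.univ : Finset (Fin n)).val.map fun i =>
        (X i.succ : MvPolynomial (Fin (n + 1)) ℚ)).esymm e := fun e => by
    simp only [esymm, map_sum, map_prod, rename_X, Finset.esymm_map_val]
  rw [h, h, esymm_eq_multiset_esymm, Fin.univ_succ, Finset.cons_val, Multiset.map_cons,
    Finset.map_val, Multiset.map_map]
  simp only [Multiset.esymm, Multiset.powersetCard_cons, Multiset.map_add, Multiset.sum_add,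
    Multiset.map_map, Function.comp_def, Multiset.prod_cons, Multiset.sum_map_mul_left]
  rfl

theorem esymm_mem_idealI {n k d : ℕ} (s : ℕ) (h : n < d + k) :
    esymm (Fin n) ℚ d ∈ idealI n k s := by
  rcases le_or_gt d n with hd | hd
  · exact Ideal.subset_span (Or.inr ⟨d, h, hd, rfl⟩)
  · rw [esymm, Finset.powersetCard_eq_empty.2 (by simpa using hd), Finset.sum_empty]
    exact zero_mem _

theorem X_pow_mem_idealI {n : ℕ} (k s : ℕ) (i : Fin n) : X i ^ s ∈ idealI n k s :=
  Ideal.subset_span (Or.inl ⟨i, rfl⟩)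

/-- Iterating `e_d(x₁, …, xₙ) x₀ = e_{d+1}(x₀, …, xₙ) - e_{d+1}(x₁, …, xₙ)` until the degree
exceeds `n`. -/
theorem X_zero_pow_mul_esymm_mem {n k s j d : ℕ} (hj : j ≤ k) (h : n < d + j) :
    X 0 ^ j * rename Fin.succ (esymm (Fin n) ℚ d) ∈ idealI (n + 1) k s := by
  induction j generalizing d with
  | zero =>
    rw [esymm, Finset.powersetCard_eq_empty.2 (by simpa using h), Finset.sum_empty, map_zero,
      mul_zero]
    exact zero_mem _
  | succ j ih =>
    have h1 : X 0 ^ (j + 1) * rename Fin.succ (esymm (Fin n) ℚ d) =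
        X 0 ^ j * esymm (Fin (n + 1)) ℚ (d + 1) -
          X 0 ^ j * rename Fin.succ (esymm (Fin n) ℚ (d + 1)) := by
      rw [esymm_fin_succ]
      ring
    rw [h1]
    exact sub_mem (Ideal.mul_mem_left _ _ (esymm_mem_idealI s (by omega)))
      (ih (by omega) (by omega))

/-- Generators with `n + 1 < d + k` lift from `n` to `n + 1` variables, modulo `x₀`. -/
theorem rename_esymm_mem {n k s d : ℕ} (h : n + 1 < d + k) :
    rename Fin.succ (esymm (Fin n) ℚ d) ∈ idealI (n + 1) k s ⊔ Ideal.span {X 0} := by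
  rcases d with _ | d
  · rw [esymm_zero, map_one, ← esymm_zero (Fin (n + 1)) ℚ]
    exact Ideal.mem_sup_left (esymm_mem_idealI s h)
  · rw [eq_sub_of_add_eq (esymm_fin_succ n d).symm]
    exact sub_mem (Ideal.mem_sup_left (esymm_mem_idealI s h))
      (Ideal.mem_sup_right (Ideal.mul_mem_right _ _ (Ideal.subset_span rfl)))

theorem rename_X_pow_mem {n : ℕ} (k s : ℕ) (i : Fin n) :
    rename Fin.succ (X i ^ s) ∈ idealI (n + 1) k s ⊔ Ideal.span {X 0} := by
  rw [map_pow, rename_X]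
  exact Ideal.mem_sup_left (X_pow_mem_idealI k s _)

theorem X_zero_pow_mul_mem {n k s : ℕ} {p : MvPolynomial (Fin (n + 1)) ℚ}
    (hp : p ∈ idealI (n + 1) k s ⊔ Ideal.span {X 0}) (j : ℕ) :
    X 0 ^ j * p ∈ idealI (n + 1) k s ⊔ Ideal.span {X 0 ^ (j + 1)} := by
  obtain ⟨a, ha, b, hb, rfl⟩ := Submodule.mem_sup.1 hp
  obtain ⟨c, rfl⟩ := Ideal.mem_span_singleton.1 hb
  rw [mul_add, ← mul_assoc, ← pow_succ]
  exact add_mem (Ideal.mem_sup_left (Ideal.mul_mem_left _ _ ha))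
    (Ideal.mem_sup_right (Ideal.mul_mem_right _ _ (Ideal.subset_span rfl)))

/-- The ideal for `(n, k, s)` lifts to the ideal for `(n + 1, k + 1, s)` modulo `x₀`. -/
theorem X_zero_pow_mul_rename_mem_of_lt {n k s j : ℕ} {g : MvPolynomial (Fin n) ℚ}
    (hg : g ∈ idealI n k s) :
    X 0 ^ j * rename Fin.succ g ∈ idealI (n + 1) (k + 1) s ⊔ Ideal.span {X 0 ^ (j + 1)} := by
  refine X_zero_pow_mul_mem ?_ j
  have h : idealI n k s ≤ (idealI (n + 1) (k + 1) s ⊔ Ideal.span {X 0}).comap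
      (rename Fin.succ : _ →ₐ[ℚ] MvPolynomial (Fin (n + 1)) ℚ) := by
    refine Ideal.span_le.2 ?_
    rintro _ (⟨i, rfl⟩ | ⟨d, h1, -, rfl⟩)
    · exact rename_X_pow_mem _ _ _
    · exact rename_esymm_mem (by omega)
  exact h hg

/-- For `k ≤ j` the ideal for `(n, k, s)`, multiplied by `x₀ ^ j`, lifts to the ideal for
`(n + 1, k, s)` modulo `x₀ ^ (j + 1)`. The generator `e_{n-k+1}` does not lift modulo `x₀`; its
multiple by `x₀ ^ k` does. -/
theorem X_zero_pow_mul_rename_mem_of_le {n k s j : ℕ} (hj : k ≤ j) {g : MvPolynomial (Fin n) ℚ}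
    (hg : g ∈ idealI n k s) :
    X 0 ^ j * rename Fin.succ g ∈ idealI (n + 1) k s ⊔ Ideal.span {X 0 ^ (j + 1)} := by
  induction hg using Submodule.span_induction with
  | zero => simp
  | add x y _ _ hx hy => rw [map_add, mul_add]; exact add_mem hx hy
  | smul a x _ hx =>
    rw [smul_eq_mul, map_mul, mul_left_comm]
    exact Ideal.mul_mem_left _ _ hx
  | mem x hx =>
    rcases hx with ⟨i, rfl⟩ | ⟨d, h1, -, rfl⟩
    · exact X_zero_pow_mul_mem (rename_X_pow_mem _ _ _) j
    · rcases (show n + 1 < d + k ∨ n + 1 = d + k by omega) with h | h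
      · exact X_zero_pow_mul_mem (rename_esymm_mem h) j
      · obtain ⟨i, rfl⟩ := Nat.exists_eq_add_of_le hj
        rw [show (X 0 : MvPolynomial (Fin (n + 1)) ℚ) ^ (k + i) *
          rename Fin.succ (esymm (Fin n) ℚ d) = X 0 ^ k * rename Fin.succ (esymm (Fin n) ℚ d) *
            X 0 ^ i by ring]
        exact Ideal.mem_sup_left (Ideal.mul_mem_right _ _ (X_zero_pow_mul_esymm_mem le_rfl h1))

theorem finSuccEquiv_rename_succ {n : ℕ} (g : MvPolynomial (Fin n) ℚ) :
    finSuccEquiv ℚ n (rename Fin.succ g) = Polynomial.C g := by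
  induction g using MvPolynomial.induction_on with
  | C c => simp [finSuccEquiv_apply]
  | add f g hf hg => simp only [map_add, hf, hg]
  | mul_X f i hf => rw [map_mul, map_mul, hf, rename_X, finSuccEquiv_X_succ, map_mul]

theorem exists_eq_rename_add {n : ℕ} (f : MvPolynomial (Fin (n + 1)) ℚ) :
    ∃ g h, f = rename Fin.succ g + X 0 * h := by
  refine ⟨(finSuccEquiv ℚ n f).coeff 0, (finSuccEquiv ℚ n).symm (finSuccEquiv ℚ n f).divX, ?_⟩
  apply (finSuccEquiv ℚ n).injective
  rw [map_add, map_mul, AlgEquiv.apply_symm_apply, finSuccEquiv_X_zero, finSuccEquiv_rename_succ]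
  conv_lhs => rw [← Polynomial.X_mul_divX_add (finSuccEquiv ℚ n f), add_comm]

/-! ### The ideal annihilates the superspace Vandermonde -/

/-- Up to a scalar `∂^m` takes `x^b` to `x^(b - m)`; the scalar vanishes unless `m ≤ b`, where the
truncated subtraction is the true one. -/
theorem diffHom_monomial_tmul {n : ℕ} (m b : Fin n →₀ ℕ) (q : ExteriorAlgebra ℚ (Fin n →₀ ℚ)) :
    ∃ c : ℚ, diffHom n (monomial m 1) (monomial b 1 ⊗ₜ q) = c • (monomial (b - m) 1 ⊗ₜ q) ∧
      (¬ m ≤ b → c = 0) := by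
  have hadd : ∀ m m' : Fin n →₀ ℕ,
      (∀ b, ∃ c : ℚ, diffHom n (monomial m 1) (monomial b 1 ⊗ₜ q) = c • (monomial (b - m) 1 ⊗ₜ q) ∧
        (¬ m ≤ b → c = 0)) →
      (∀ b, ∃ c : ℚ, diffHom n (monomial m' 1) (monomial b 1 ⊗ₜ q) =
        c • (monomial (b - m') 1 ⊗ₜ q) ∧ (¬ m' ≤ b → c = 0)) →
      ∀ b, ∃ c : ℚ, diffHom n (monomial (m + m') 1) (monomial b 1 ⊗ₜ q) =
        c • (monomial (b - (m + m')) 1 ⊗ₜ q) ∧ (¬ m + m' ≤ b → c = 0) := by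
    intro m m' h h' b
    obtain ⟨c', hc', h0'⟩ := h' b
    obtain ⟨c, hc, h0⟩ := h (b - m')
    refine ⟨c' * c, ?_, fun hle => ?_⟩
    · have e : monomial (m + m') (1 : ℚ) = monomial m 1 * monomial m' 1 := by
        rw [monomial_mul, one_mul]
      rw [e, map_mul, Module.End.mul_apply, hc', map_smul, hc, smul_smul, tsub_tsub, add_comm m m']
    · by_cases h1 : m' ≤ b
      · rw [h0 fun h2 => hle ?_, mul_zero]
        exact (le_tsub_iff_right h1).1 h2
      · rw [h0' h1, zero_mul]
  induction m using Finsupp.induction_linear generalizing b with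
  | zero => exact ⟨1, by simp, fun h => absurd zero_le h⟩
  | add m m' hm hm' => exact hadd m m' hm hm' b
  | single i e =>
    induction e generalizing b with
    | zero => exact ⟨1, by simp, fun h => absurd (by simp) h⟩
    | succ e ih =>
      rw [Finsupp.single_add]
      refine hadd _ _ ih (fun b => ⟨b i, ?_, fun h => ?_⟩) b
      · change diffHom n (X i) _ = _
        rw [diffHom_X]
        change pderiv i (monomial b 1) ⊗ₜ q = _
        rw [pderiv_monomial, one_mul, TensorProduct.smul_tmul', smul_monomial, smul_eq_mul, mul_one]
      · by_contra h1
        exact h (Finsupp.single_le_iff.2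
          (Nat.one_le_iff_ne_zero.2 fun h2 => h1 (by rw [h2, Nat.cast_zero])))

/-- The antisymmetrization operator as a linear map. -/
def antisymmetrizeHom (n : ℕ) : Superspace n →ₗ[ℚ] Superspace n :=
  ∑ w : Equiv.Perm (Fin n), ((Equiv.Perm.sign w : ℤ) : ℚ) • superRep n w

theorem antisymmetrizeHom_apply {n : ℕ} (t : Superspace n) :
    antisymmetrizeHom n t = antisymmetrize t := by
  simp [antisymmetrizeHom, antisymmetrize]

/-- Antisymmetrization kills whatever an odd permutation fixes. -/
theorem antisymmetrize_eq_zero {n : ℕ} {t : Superspace n} {τ : Equiv.Perm (Fin n)}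
    (h : superRep n τ t = t) (hτ : Equiv.Perm.sign τ = -1) : antisymmetrize t = 0 := by
  have h1 : antisymmetrize t = (-1 : ℚ) • antisymmetrize t := by
    conv_lhs => rw [antisymmetrize]
    rw [antisymmetrize, Finset.smul_sum]
    refine Fintype.sum_equiv (Equiv.mulRight τ) _ _ fun w => ?_
    rw [Equiv.coe_mulRight, map_mul, map_mul, hτ, Module.End.mul_apply, h, smul_smul]
    congr 1
    simp
  have h2 : (2 : ℚ) • antisymmetrize t = 0 := by
    have h3 : (1 + (-1) : ℚ) • antisymmetrize t = antisymmetrize t + antisymmetrize t := by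
      rw [add_smul, one_smul, ← h1]
    rw [two_smul, ← h3, add_neg_cancel, zero_smul]
  exact (smul_eq_zero.1 h2).resolve_left two_ne_zero

theorem diffHom_esymm_antisymmetrize {n : ℕ} (d : ℕ) (t : Superspace n) :
    diffHom n (esymm (Fin n) ℚ d) (antisymmetrize t) =
      antisymmetrize (diffHom n (esymm (Fin n) ℚ d) t) := by
  simp only [antisymmetrize, map_sum, map_smul, superRep_diffHom, rename_esymm]

/-- The product `θ₁ ⋯ θ_r`. -/
def thetaProd (r k : ℕ) : ExteriorAlgebra ℚ (Fin (r + k) →₀ ℚ) :=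
  ExteriorAlgebra.ιMulti ℚ r fun j => Finsupp.single (Fin.castAdd k j) 1

/-- The exponent vector of the monomial whose antisymmetrization is the superspace Vandermonde. -/
def stairExp {r : ℕ} (k : ℕ) (a : Fin r → ℕ) : Fin (r + k) →₀ ℕ :=
  Finsupp.equivFunOnFinite.symm (Fin.append a fun j : Fin k => k - 1 - (j : ℕ))

@[simp]
theorem stairExp_castAdd {r k : ℕ} (a : Fin r → ℕ) (j : Fin r) :
    stairExp k a (Fin.castAdd k j) = a j :=
  Fin.append_left a (fun j : Fin k => k - 1 - (j : ℕ)) j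

@[simp]
theorem stairExp_natAdd {r k : ℕ} (a : Fin r → ℕ) (j : Fin k) :
    stairExp k a (Fin.natAdd r j) = k - 1 - (j : ℕ) :=
  Fin.append_right a (fun j : Fin k => k - 1 - (j : ℕ)) j

theorem vandermonde_eq {r k : ℕ} (a : Fin r → ℕ) :
    vandermonde k a = antisymmetrize (monomial (stairExp k a) 1 ⊗ₜ thetaProd r k) := by
  rw [vandermonde]
  congr 1
  have h1 : (List.ofFn fun j : Fin r => theta (Fin.castAdd k j)).prod =
      (1 : MvPolynomial (Fin (r + k)) ℚ) ⊗ₜ thetaProd r k := by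
    rw [thetaProd, ExteriorAlgebra.ιMulti_apply]
    change _ = Algebra.TensorProduct.includeRight _
    rw [map_list_prod, List.map_ofFn]
    rfl
  rw [h1, ofPoly, Algebra.TensorProduct.tmul_mul_tmul, mul_one, one_mul, monomial_eq, map_one,
    one_mul, Finsupp.prod_fintype _ _ (by simp)]
  rfl

theorem superRep_monomial_tmul {n : ℕ} (w : Equiv.Perm (Fin n)) (b : Fin n →₀ ℕ)
    (q : ExteriorAlgebra ℚ (Fin n →₀ ℚ)) :
    superRep n w (monomial b 1 ⊗ₜ q) =
      monomial (b.mapDomain w) 1 ⊗ₜ ExteriorAlgebra.map (Finsupp.lmapDomain ℚ ℚ w) q := by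
  change permHom w (monomial b 1 ⊗ₜ q) = _
  rw [permHom, Algebra.TensorProduct.map_tmul, rename_monomial]

theorem map_thetaProd {r k : ℕ} (w : Equiv.Perm (Fin (r + k))) :
    ExteriorAlgebra.map (Finsupp.lmapDomain ℚ ℚ w) (thetaProd r k) =
      ExteriorAlgebra.ιMulti ℚ r fun j => Finsupp.single (w (Fin.castAdd k j)) 1 := by
  rw [thetaProd, ExteriorAlgebra.map_apply_ιMulti]
  congr 1
  ext1 j
  simp

/-- Two equal exponents at places without a `θ` are killed by antisymmetrization. -/
theorem antisymmetrize_eq_zero_of_eq {r k : ℕ} {b : Fin (r + k) →₀ ℕ} {i j : Fin k} (hij : i ≠ j)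
    (hb : b (Fin.natAdd r i) = b (Fin.natAdd r j)) :
    antisymmetrize (monomial b 1 ⊗ₜ thetaProd r k) = 0 := by
  have hne : Fin.natAdd r i ≠ Fin.natAdd r j := fun h => hij (Fin.natAdd_injective _ _ h)
  refine antisymmetrize_eq_zero (τ := Equiv.swap (Fin.natAdd r i) (Fin.natAdd r j)) ?_
    (Equiv.Perm.sign_swap hne)
  rw [superRep_monomial_tmul, map_thetaProd]
  congr 2
  · congr 1
    ext l
    rw [Finsupp.mapDomain_equiv_apply, Equiv.symm_swap, Equiv.swap_apply_def]
    split_ifs with h1 h2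
    · rw [h1, hb]
    · rw [h2, hb]
    · rfl
  · ext1 l
    rw [Equiv.swap_apply_of_ne_of_ne] <;>
    · intro h
      have := congrArg Fin.val h
      simp at this
      omega

/-- `∂ᵢ^s` kills `Δ`, because all exponents in `Δ` are less than `s`. -/
theorem diffHom_X_pow_vandermonde {r k s : ℕ} (hks : k ≤ s) {a : Fin r → ℕ}
    (ha : ∀ i, a i < s) (i : Fin (r + k)) :
    diffHom (r + k) (X i ^ s) (vandermonde k a) = 0 := by
  rw [vandermonde_eq, antisymmetrize, map_sum]
  refine Finset.sum_eq_zero fun w _ => ?_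
  rw [map_smul, superRep_monomial_tmul, X_pow_eq_monomial]
  obtain ⟨c, h1, h2⟩ := diffHom_monomial_tmul (Finsupp.single i s)
    ((stairExp k a).mapDomain w) (ExteriorAlgebra.map (Finsupp.lmapDomain ℚ ℚ w) (thetaProd r k))
  rw [h1, h2, zero_smul, smul_zero]
  rw [Finsupp.single_le_iff, Finsupp.mapDomain_equiv_apply, not_le]
  refine Fin.addCases (fun j => ?_) (fun j => ?_) (w.symm i)
  · simpa using ha j
  · rw [stairExp_natAdd]
    have := j.2
    omega

/-- `e_d(∂)` kills `Δ` for `d > r`: it commutes with antisymmetrization, and each squarefree `∂_S`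
with `#S = d` creates two equal exponents, or a negative one, among the consecutive exponents
`k - 1, …, 1, 0` of the places without a `θ`. -/
theorem diffHom_esymm_vandermonde {r k d : ℕ} (a : Fin r → ℕ) (hd : r < d) :
    diffHom (r + k) (esymm (Fin (r + k)) ℚ d) (vandermonde k a) = 0 := by
  rw [vandermonde_eq, diffHom_esymm_antisymmetrize, esymm_eq_sum_monomial, map_sum,
    LinearMap.sum_apply, ← antisymmetrizeHom_apply, map_sum]
  refine Finset.sum_eq_zero fun S hS => ?_
  obtain ⟨c, h1, h2⟩ := diffHom_monomial_tmul (∑ i ∈ S, Finsupp.single i 1)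
    (stairExp k a) (thetaProd r k)
  have hm : ∀ l, (∑ i ∈ S, Finsupp.single i 1 : Fin (r + k) →₀ ℕ) l = if l ∈ S then 1 else 0 := by
    intro l
    simp [Finsupp.finsetSum_apply, Finsupp.single_apply]
  rw [h1, map_smul, antisymmetrizeHom_apply]
  by_cases hle : (∑ i ∈ S, Finsupp.single i 1 : Fin (r + k) →₀ ℕ) ≤ stairExp k a
  swap
  · rw [h2 hle, zero_smul]
  -- `S` is too large to consist of places carrying a `θ`, so it has a last place without one.
  have hT : (Finset.univ.filter fun j : Fin k => Fin.natAdd r j ∈ S).Nonempty := by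
    by_contra hT
    rw [Finset.not_nonempty_iff_eq_empty, Finset.filter_eq_empty_iff] at hT
    have hsub : S ⊆ Finset.univ.image (Fin.castAdd k) := by
      intro i
      refine Fin.addCases (fun j _ => Finset.mem_image_of_mem _ (Finset.mem_univ j))
        (fun j hj => absurd hj (hT (Finset.mem_univ j))) i
    have h3 := (Finset.card_le_card hsub).trans Finset.card_image_le
    rw [(Finset.mem_powersetCard.1 hS).2, Finset.card_univ, Fintype.card_fin] at h3
    omega
  obtain ⟨j, hj, hmax⟩ := Finset.exists_maximal hT
  have hjS : Fin.natAdd r j ∈ S := (Finset.mem_filter.1 hj).2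
  have h4 := hle (Fin.natAdd r j)
  rw [hm, if_pos hjS, stairExp_natAdd] at h4
  have hj1 : (j : ℕ) + 1 < k := by omega
  have hnot : Fin.natAdd r ⟨(j : ℕ) + 1, hj1⟩ ∉ S := by
    intro h
    have h5 := hmax (Finset.mem_filter.2 ⟨Finset.mem_univ _, h⟩)
      (Fin.le_def.2 (Nat.le_succ _))
    have h6 : (j : ℕ) + 1 ≤ j := Fin.le_def.1 h5
    omega
  rw [antisymmetrize_eq_zero_of_eq (i := j) (j := ⟨(j : ℕ) + 1, hj1⟩), smul_zero]
  · intro h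
    have : (j : ℕ) = j + 1 := congrArg Fin.val h
    omega
  · rw [Finsupp.tsub_apply, Finsupp.tsub_apply, hm, hm, if_pos hjS, if_neg hnot, stairExp_natAdd,
      stairExp_natAdd]
    simp only
    omega

theorem diffHom_vandermonde_of_mem {r k s : ℕ} (hks : k ≤ s) {a : Fin r → ℕ}
    (ha : ∀ i, a i < s) {f : MvPolynomial (Fin (r + k)) ℚ} (hf : f ∈ idealI (r + k) k s) :
    diffHom (r + k) f (vandermonde k a) = 0 := by
  induction hf using Submodule.span_induction with
  | zero => simp
  | add x y _ _ hx hy => rw [map_add, LinearMap.add_apply, hx, hy, add_zero]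
  | smul c x _ hx => rw [smul_eq_mul, map_mul, Module.End.mul_apply, hx, map_zero]
  | mem x hx =>
    rcases hx with ⟨i, rfl⟩ | ⟨d, h1, -, rfl⟩
    · exact diffHom_X_pow_vandermonde hks ha i
    · exact diffHom_esymm_vandermonde a (by omega)

/-! ### The components as contractions of the superspace Vandermonde -/

/-- The functional on the exterior algebra extracting the coefficient of `θ₁ ⋯ θ_r`. -/
def topCoeff (r k : ℕ) : ExteriorAlgebra ℚ (Fin (r + k) →₀ ℚ) →ₗ[ℚ] ℚ :=
  ExteriorAlgebra.liftAlternating (Pi.single r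
    ((Matrix.detRowAlternating (n := Fin r) (R := ℚ)).compLinearMap
      (LinearMap.funLeft ℚ ℚ (Fin.castAdd k) ∘ₗ Finsupp.lcoeFun)))

theorem topCoeff_map_thetaProd {r k : ℕ} (w : Equiv.Perm (Fin (r + k))) :
    topCoeff r k (ExteriorAlgebra.map (Finsupp.lmapDomain ℚ ℚ w) (thetaProd r k)) =
      ∑ σ : Equiv.Perm (Fin r), ((Equiv.Perm.sign σ : ℤ) : ℚ) *
        if ∀ j, w (Fin.castAdd k (σ j)) = Fin.castAdd k j then 1 else 0 := by
  rw [map_thetaProd, topCoeff, ExteriorAlgebra.liftAlternating_apply_ιMulti, Pi.single_eq_same,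
    AlternatingMap.compLinearMap_apply]
  change Matrix.det (Matrix.of fun i => (LinearMap.funLeft ℚ ℚ (Fin.castAdd k) ∘ₗ Finsupp.lcoeFun)
    (Finsupp.single (w (Fin.castAdd k i)) (1 : ℚ))) = _
  rw [Matrix.det_apply']
  refine Finset.sum_congr rfl fun σ _ => ?_
  congr 1
  have h : ∀ i : Fin r, (LinearMap.funLeft ℚ ℚ (Fin.castAdd k) ∘ₗ Finsupp.lcoeFun)
      (Finsupp.single (w (Fin.castAdd k (σ i))) (1 : ℚ)) i =
        if w (Fin.castAdd k (σ i)) = Fin.castAdd k i then 1 else 0 := fun i => by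
    change Finsupp.single (w (Fin.castAdd k (σ i))) (1 : ℚ) (Fin.castAdd k i) = _
    rw [Finsupp.single_apply]
  refine (Finset.prod_congr rfl fun i _ => h i).trans ?_
  rw [Finset.prod_ite_zero]
  simp

/-- A permutation of the first `r` places. -/
def extendPerm {r : ℕ} (k : ℕ) (σ : Equiv.Perm (Fin r)) : Equiv.Perm (Fin (r + k)) :=
  finSumFinEquiv.permCongr (Equiv.Perm.sumCongr σ 1)

@[simp]
theorem extendPerm_castAdd {r k : ℕ} (σ : Equiv.Perm (Fin r)) (j : Fin r) :
    extendPerm k σ (Fin.castAdd k j) = Fin.castAdd k (σ j) := by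
  simp [extendPerm]

@[simp]
theorem extendPerm_natAdd {r k : ℕ} (σ : Equiv.Perm (Fin r)) (j : Fin k) :
    extendPerm k σ (Fin.natAdd r j) = Fin.natAdd r j := by
  simp [extendPerm]

theorem sign_extendPerm {r k : ℕ} (σ : Equiv.Perm (Fin r)) :
    Equiv.Perm.sign (extendPerm k σ) = Equiv.Perm.sign σ := by
  simp [extendPerm, Equiv.Perm.sign_permCongr]

/-- Only permutations mapping the first `r` places to themselves contribute to the coefficient of
`θ₁ ⋯ θ_r`; as the exponents there are equal, they may be normalized to fix these places, each such
permutation arising `r!` times. -/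
theorem contract_vandermonde_eq_sum {r k e : ℕ} :
    contract (topCoeff r k) (vandermonde k fun _ : Fin r => e) =
      (r.factorial : ℚ) • ∑ w : Equiv.Perm (Fin (r + k)), ((Equiv.Perm.sign w : ℤ) : ℚ) •
        if ∀ j, w (Fin.castAdd k j) = Fin.castAdd k j then
          rename w (monomial (stairExp k fun _ : Fin r => e) (1 : ℚ)) else 0 := by
  have h1 : ∀ w : Equiv.Perm (Fin (r + k)), contract (topCoeff r k)
      (superRep _ w (monomial (stairExp k fun _ : Fin r => e) 1 ⊗ₜ thetaProd r k)) =
      ∑ σ : Equiv.Perm (Fin r), ((Equiv.Perm.sign σ : ℤ) : ℚ) •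
        if ∀ j, w (Fin.castAdd k (σ j)) = Fin.castAdd k j then
          rename w (monomial (stairExp k fun _ : Fin r => e) (1 : ℚ)) else 0 := by
    intro w
    rw [superRep_monomial_tmul, contract_tmul, topCoeff_map_thetaProd, Finset.sum_smul,
      rename_monomial]
    refine Finset.sum_congr rfl fun σ _ => ?_
    split_ifs <;> simp
  rw [vandermonde_eq, antisymmetrize, map_sum]
  simp only [map_smul, h1]
  have h2 : (r.factorial : ℚ) = ∑ σ : Equiv.Perm (Fin r), (1 : ℚ) := by
    simp [Fintype.card_perm]
  rw [h2, Finset.sum_smul]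
  simp only [one_smul]
  simp only [Finset.smul_sum (s := (Finset.univ : Finset (Equiv.Perm (Fin r))))]
  rw [Finset.sum_comm]
  refine Finset.sum_congr rfl fun σ _ => ?_
  refine Fintype.sum_equiv (Equiv.mulRight (extendPerm k σ)) _ _ fun w => ?_
  have h3 : rename (w * extendPerm k σ) (monomial (stairExp k fun _ : Fin r => e) (1 : ℚ)) =
      rename w (monomial (stairExp k fun _ : Fin r => e) (1 : ℚ)) := by
    rw [Equiv.Perm.coe_mul, ← rename_rename, rename_monomial (extendPerm k σ)]
    suffices h4 : (stairExp k fun _ : Fin r => e).mapDomain (extendPerm k σ) =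
      stairExp k fun _ : Fin r => e by rw [h4]
    ext l
    obtain ⟨l, rfl⟩ := (extendPerm k σ).surjective l
    rw [Finsupp.mapDomain_equiv_apply, Equiv.symm_apply_apply]
    refine Fin.addCases (fun j => ?_) (fun j => ?_) l <;> simp
  rw [Equiv.coe_mulRight, h3, Equiv.Perm.sign_mul, sign_extendPerm, smul_smul]
  simp only [Equiv.Perm.coe_mul, Function.comp_apply, extendPerm_castAdd]
  congr 1
  push_cast
  ring

theorem block_natAdd (s r k : ℕ) :
    block s (Fin.natAdd r : Fin k → Fin (r + k)) =
      (∏ j : Fin r, X (Fin.castAdd k j) ^ (s - 1)) *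
        ∏ i : Fin k, ∏ j ∈ Finset.Ioi i, (X (Fin.natAdd r j) - X (Fin.natAdd r i)) := by
  rw [block, Fin.prod_univ_add]
  congr 1
  have h1 : ∀ i : Fin r, ¬ ∃ j : Fin k, Fin.natAdd r j = Fin.castAdd k i := by
    rintro i ⟨j, h⟩
    have := congrArg Fin.val h
    simp at this
    omega
  simp [h1]

/-- The coefficient of `θ₁ ⋯ θ_r` in the superspace Vandermonde, as a block triangular
determinant. -/
theorem contract_vandermonde {r k s : ℕ} :
    ∃ c : ℚ, c ≠ 0 ∧ contract (topCoeff r k) (vandermonde k fun _ : Fin r => s - 1) =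
      c • block s (Fin.natAdd r : Fin k → Fin (r + k)) := by
  let y : Fin k → MvPolynomial (Fin (r + k)) ℚ := fun j => X (Fin.natAdd r j)
  -- The upper right block does not affect the determinant; it is chosen so that row `i` carries
  -- only powers of `xᵢ`.
  let N : Matrix (Fin r ⊕ Fin k) (Fin r ⊕ Fin k) (MvPolynomial (Fin (r + k)) ℚ) :=
    Matrix.fromBlocks (Matrix.diagonal fun j => X (Fin.castAdd k j) ^ (s - 1))
      (Matrix.of fun l i => X (Fin.castAdd k l) ^ (k - 1 - (i : ℕ))) 0
      ((Matrix.vandermonde y).submatrix id Fin.revPerm)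
  have hN : ∑ w : Equiv.Perm (Fin (r + k)), ((Equiv.Perm.sign w : ℤ) : ℚ) •
      (if ∀ j, w (Fin.castAdd k j) = Fin.castAdd k j then
        rename w (monomial (stairExp k fun _ : Fin r => s - 1) (1 : ℚ)) else 0) = N.det := by
    rw [← Matrix.det_reindex_self finSumFinEquiv N, Matrix.det_apply']
    refine Finset.sum_congr rfl fun w _ => ?_
    have hsm : ∀ p : MvPolynomial (Fin (r + k)) ℚ, ((Equiv.Perm.sign w : ℤ) : ℚ) • p =
        ((Equiv.Perm.sign w : ℤ) : MvPolynomial (Fin (r + k)) ℚ) * p := fun p => by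
      rw [Int.cast_smul_eq_zsmul, zsmul_eq_mul]
    rw [hsm]
    congr 1
    rw [Fin.prod_univ_add]
    have e1 : ∀ j : Fin r, Matrix.reindex finSumFinEquiv finSumFinEquiv N (w (Fin.castAdd k j))
        (Fin.castAdd k j) = if w (Fin.castAdd k j) = Fin.castAdd k j then
          X (w (Fin.castAdd k j)) ^ (s - 1) else 0 := by
      intro j
      refine Fin.addCases (fun l => ?_) (fun l => ?_) (w (Fin.castAdd k j))
      · simp [N, Matrix.diagonal_apply]
      · have : Fin.natAdd r l ≠ Fin.castAdd k j := fun h => by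
          have := congrArg Fin.val h
          simp at this
          omega
        simp [N, this]
    have e2 : ∀ j : Fin k, Matrix.reindex finSumFinEquiv finSumFinEquiv N (w (Fin.natAdd r j))
        (Fin.natAdd r j) = X (w (Fin.natAdd r j)) ^ (k - 1 - (j : ℕ)) := by
      intro j
      have hr : (Fin.rev j : ℕ) = k - 1 - (j : ℕ) := by rw [Fin.val_rev]; omega
      refine Fin.addCases (fun l => ?_) (fun l => ?_) (w (Fin.natAdd r j))
      · simp [N]
      · rw [← hr]
        simp [N, y, Matrix.vandermonde_apply]
    simp only [e1, e2]
    rw [Finset.prod_ite_zero]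
    simp only [Finset.mem_univ, true_implies]
    split_ifs
    · rw [monomial_eq, map_one, one_mul, Finsupp.prod_fintype _ _ (by simp), Fin.prod_univ_add]
      simp
    · rw [zero_mul]
  have hdet : N.det = (∏ j : Fin r, X (Fin.castAdd k j) ^ (s - 1)) *
      (((Equiv.Perm.sign (Fin.revPerm : Equiv.Perm (Fin k)) : ℤ) : MvPolynomial (Fin (r + k)) ℚ) *
        ∏ i : Fin k, ∏ j ∈ Finset.Ioi i, (y j - y i)) := by
    rw [Matrix.det_fromBlocks_zero₂₁, Matrix.det_diagonal, Matrix.det_permute',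
      Matrix.det_vandermonde]
  refine ⟨r.factorial * ((Equiv.Perm.sign (Fin.revPerm : Equiv.Perm (Fin k)) : ℤ) : ℚ),
    mul_ne_zero (Nat.cast_ne_zero.2 r.factorial_ne_zero) (by simp), ?_⟩
  rw [contract_vandermonde_eq_sum, hN, hdet, block_natAdd, ← smul_smul, Int.cast_smul_eq_zsmul,
    zsmul_eq_mul]
  congr 1
  ring

theorem rename_block {n m k : ℕ} (s : ℕ) (v : Fin k → Fin n) (σ : Fin n ≃ Fin m) :
    rename σ (block s v) = block s (σ ∘ v) := by
  rw [block, block, map_mul, map_prod, map_prod]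
  congr 1
  · refine Fintype.prod_equiv σ _ _ fun i => ?_
    simp only [Function.comp_apply, σ.injective.eq_iff, apply_ite (rename σ), map_one, map_pow,
      rename_X]
  · simp

/-- Contracting with a permuted functional: the components are permuted by `𝔖ₙ`. -/
theorem contract_comp_map {n : ℕ} (φ : ExteriorAlgebra ℚ (Fin n →₀ ℚ) →ₗ[ℚ] ℚ)
    (σ : Equiv.Perm (Fin n)) (t : Superspace n) :
    contract (φ ∘ₗ (ExteriorAlgebra.map (Finsupp.lmapDomain ℚ ℚ ⇑σ⁻¹)).toLinearMap) t =
      rename σ (contract φ (superRep n σ⁻¹ t)) := by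
  induction t using TensorProduct.induction_on with
  | zero => simp
  | tmul p q =>
    have h : superRep n σ⁻¹ (p ⊗ₜ q) =
      rename (σ⁻¹ : Equiv.Perm (Fin n)) p ⊗ₜ
        ExteriorAlgebra.map (Finsupp.lmapDomain ℚ ℚ (σ⁻¹ : Equiv.Perm (Fin n))) q := rfl
    rw [h, contract_tmul, contract_tmul, map_smul, rename_rename, ← Equiv.Perm.coe_mul,
      mul_inv_cancel, Equiv.Perm.coe_one, rename_id_apply]
    rfl
  | add a b ha hb => simp only [map_add, ha, hb]

theorem exists_perm_natAdd {r k : ℕ} {v : Fin k → Fin (r + k)} (hv : Function.Injective v) :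
    ∃ σ : Equiv.Perm (Fin (r + k)), v = σ ∘ Fin.natAdd r := by
  let e : Set.range (Fin.natAdd r : Fin k → Fin (r + k)) ≃ Set.range v :=
    (Equiv.ofInjective _ (Fin.natAdd_injective k r)).symm.trans (Equiv.ofInjective _ hv)
  refine ⟨e.extendSubtype, funext fun j => ?_⟩
  rw [Function.comp_apply, Equiv.extendSubtype_apply_of_mem _ _ ⟨j, rfl⟩]
  simp only [e, Equiv.trans_apply]
  have : (⟨Fin.natAdd r j, ⟨j, rfl⟩⟩ : Set.range (Fin.natAdd r : Fin k → Fin (r + k))) =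
    Equiv.ofInjective _ (Fin.natAdd_injective k r) j := rfl
  rw [this, Equiv.symm_apply_apply]
  rfl

/-- Every component is a contraction of the superspace Vandermonde, up to a nonzero scalar. -/
theorem exists_contract_eq_block {r k : ℕ} (s : ℕ) {v : Fin k → Fin (r + k)}
    (hv : Function.Injective v) :
    ∃ (c : ℚ) (φ : ExteriorAlgebra ℚ (Fin (r + k) →₀ ℚ) →ₗ[ℚ] ℚ), c ≠ 0 ∧
      contract φ (vandermonde k fun _ : Fin r => s - 1) = c • block s v := by
  obtain ⟨σ, rfl⟩ := exists_perm_natAdd hv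
  obtain ⟨c, hc, h⟩ := contract_vandermonde (r := r) (k := k) (s := s)
  refine ⟨((Equiv.Perm.sign σ⁻¹ : ℤ) : ℚ) * c, _, mul_ne_zero (by simp) hc,
    (contract_comp_map (topCoeff r k) σ _).trans ?_⟩
  have h1 : superRep (r + k) σ⁻¹ (vandermonde k fun _ : Fin r => s - 1) = _ :=
    superRep_antisymmetrize _ _
  rw [h1, map_smul]
  change rename σ (_ • contract (topCoeff r k) (vandermonde k fun _ : Fin r => s - 1)) = _
  rw [h, map_smul, map_smul, rename_block, smul_smul]

theorem pair_smul_left {n : ℕ} (c : ℚ) (p : MvPolynomial (Fin n) ℚ) :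
    pair (c • p) = c • pair p := by
  refine (basisMonomials (Fin n) ℚ).ext fun m => ?_
  rw [coe_basisMonomials, LinearMap.smul_apply, pair_monomial, pair_monomial, coeff_smul,
    smul_eq_mul, smul_eq_mul]
  ring

/-- If `f(∂) Δ = 0` then `(q f)(∂) Δ = 0` for all `q`, whose constant terms are the apolar
pairings with the components of `Δ`. -/
theorem killsBlocks_of_diffHom_eq_zero {r k s : ℕ} {f : MvPolynomial (Fin (r + k)) ℚ}
    (hf : diffHom (r + k) f (vandermonde k fun _ : Fin r => s - 1) = 0) :
    KillsBlocks s (r + k) k f := by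
  intro v hv q
  obtain ⟨c, φ, hc, h⟩ := exists_contract_eq_block s hv
  have h1 := coeff_zero_contract_diffHom φ (q * f) (vandermonde k fun _ : Fin r => s - 1)
  rw [map_mul, Module.End.mul_apply, hf, map_zero, map_zero, coeff_zero, h, pair_smul_left,
    LinearMap.smul_apply, smul_eq_mul, eq_comm] at h1
  exact (mul_eq_zero.1 h1).resolve_left hc

theorem killsBlocks_of_mem {n k s : ℕ} (hs : 0 < s) (hks : k ≤ s) {f : MvPolynomial (Fin n) ℚ}
    (hf : f ∈ idealI n k s) : KillsBlocks s n k f := by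
  rcases le_or_gt k n with h | h
  · obtain ⟨r, rfl⟩ := Nat.exists_eq_add_of_le' h
    exact killsBlocks_of_diffHom_eq_zero
      (diffHom_vandermonde_of_mem hks (fun _ => Nat.sub_lt hs one_pos) hf)
  · intro v hv
    have := Fintype.card_le_of_injective v hv
    simp only [Fintype.card_fin] at this
    omega

/-! ### The annihilator is the ideal -/

/-- Descending induction on the power `x₀ ^ j` dividing `f`, from `j = s` where `x₀ ^ s` is a
generator. The leading coefficient `g` of `f = x₀ ^ j (g + x₀ h)` lies in the ideal for
`(n, k - 1, s)` if `j < k` and in that for `(n, k, s)` if `k ≤ j`, so that `x₀ ^ j g` lies in the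
ideal for `(n + 1, k, s)` up to a multiple of `x₀ ^ (j + 1)`. -/
theorem mem_idealI_of_dvd {n k s : ℕ} (hks : k ≤ s)
    (ih : ∀ k ≤ s, ∀ g, KillsBlocks s n k g → g ∈ idealI n k s) {j : ℕ} (hj : j ≤ s)
    {f : MvPolynomial (Fin (n + 1)) ℚ} (hf : KillsBlocks s (n + 1) k f) (hd : X 0 ^ j ∣ f) :
    f ∈ idealI (n + 1) k s := by
  induction hj using Nat.decreasingInduction generalizing f with
  | self => exact Ideal.mem_of_dvd _ hd (X_pow_mem_idealI k s 0)
  | of_succ j hj IH =>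
    obtain ⟨f, rfl⟩ := hd
    obtain ⟨g, h, rfl⟩ := exists_eq_rename_add f
    have key : X 0 ^ j * rename Fin.succ g ∈ idealI (n + 1) k s ⊔ Ideal.span {X 0 ^ (j + 1)} := by
      rcases lt_or_ge j k with hjk | hjk
      · obtain ⟨k, rfl⟩ : ∃ k', k = k' + 1 := ⟨k - 1, by omega⟩
        exact X_zero_pow_mul_rename_mem_of_lt
          (ih k (by omega) g (hf.lead_of_le (by omega)))
      · exact X_zero_pow_mul_rename_mem_of_le hjk (ih k hks g (hf.lead_of_lt hj))
    obtain ⟨a, ha, b, hb, hab⟩ := Submodule.mem_sup.1 key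
    obtain ⟨c, rfl⟩ := Ideal.mem_span_singleton.1 hb
    have e : X 0 ^ j * (rename Fin.succ g + X 0 * h) = a + X 0 ^ (j + 1) * (c + h) := by
      rw [mul_add, ← hab, pow_succ]
      ring
    rw [e] at hf ⊢
    refine add_mem ha (IH ?_ ⟨_, rfl⟩)
    intro v hv q
    have h1 := hf v hv q
    rwa [mul_add, map_add, killsBlocks_of_mem (by omega) hks ha v hv q, zero_add] at h1

/-- A polynomial annihilating all components of the superspace Vandermonde lies in the ideal, by
induction on the number of variables. For `k > n` there are no components, and the ideal is the
unit ideal because it contains `e₀`. -/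
theorem mem_idealI_of_killsBlocks {s : ℕ} (n : ℕ) : ∀ k ≤ s, ∀ f : MvPolynomial (Fin n) ℚ,
    KillsBlocks s n k f → f ∈ idealI n k s := by
  induction n with
  | zero =>
    intro k _ f hf
    rcases Nat.eq_zero_or_pos k with rfl | hk
    · have h1 := hf Fin.elim0 (fun i => i.elim0) 1
      have h2 : f = C (coeff 0 f) := by
        rw [← constantCoeff_eq]
        exact eq_C_of_isEmpty f
      rw [one_mul, h2, ← mul_one (C _), ← smul_eq_C_mul, map_smul, ← C_1, ← monomial_zero',
        pair_monomial] at h1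
      have h3 : coeff 0 f = 0 := by simpa [block, factorial] using h1
      rw [h2, h3, C_0]
      exact zero_mem _
    · have h1 := esymm_mem_idealI s (show 0 < 0 + k by omega)
      rw [esymm_zero] at h1
      rw [(Ideal.eq_top_iff_one _).2 h1]
      trivial
  | succ n ih =>
    intro k hk f hf
    exact mem_idealI_of_dvd hk ih (Nat.zero_le s) hf (by simp)

/-- The annihilator of the superspace Vandermonde. -/
theorem mem_idealI_iff {r k s : ℕ} (hks : k ≤ s) (hs : 0 < r → 0 < s)
    (f : MvPolynomial (Fin (r + k)) ℚ) :
    f ∈ idealI (r + k) k s ↔ diffHom (r + k) f (vandermonde k fun _ : Fin r => s - 1) = 0 :=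
  ⟨diffHom_vandermonde_of_mem hks fun i => Nat.sub_lt (hs i.pos) one_pos, fun h =>
    mem_idealI_of_killsBlocks _ k hks f (killsBlocks_of_diffHom_eq_zero h)⟩

/-! ### Gradings -/

theorem tmul_mem_xHomogeneous {n d : ℕ} {p : MvPolynomial (Fin n) ℚ} (hp : p.IsHomogeneous d)
    (q : ExteriorAlgebra ℚ (Fin n →₀ ℚ)) : p ⊗ₜ q ∈ xHomogeneous n d :=
  ⟨(⟨p, hp⟩ : homogeneousSubmodule (Fin n) ℚ d) ⊗ₜ q, rfl⟩

theorem monomial_tmul_mem_xHomogeneous {n : ℕ} (b : Fin n →₀ ℕ)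
    (q : ExteriorAlgebra ℚ (Fin n →₀ ℚ)) : monomial b 1 ⊗ₜ q ∈ xHomogeneous n b.degree :=
  tmul_mem_xHomogeneous (isHomogeneous_monomial 1 rfl) q

theorem xHomogeneous_induction {n d : ℕ} {P : Superspace n → Prop} (zero : P 0)
    (add : ∀ s t, P s → P t → P (s + t)) (smul : ∀ (c : ℚ) t, P t → P (c • t))
    (mon : ∀ b q, Finsupp.degree b = d → P (monomial b 1 ⊗ₜ q)) {t : Superspace n}
    (ht : t ∈ xHomogeneous n d) : P t := by
  obtain ⟨t, rfl⟩ := ht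
  induction t using TensorProduct.induction_on with
  | zero => simpa using zero
  | add s t hs ht => rw [map_add]; exact add _ _ hs ht
  | tmul p q =>
    obtain ⟨p, hp⟩ := p
    rw [LinearMap.rTensor_tmul, Submodule.subtype_apply]
    change P (p ⊗ₜ q)
    rw [p.as_sum, TensorProduct.sum_tmul]
    refine Finset.sum_induction _ P add zero fun b hb => ?_
    have h : monomial b (coeff b p) = coeff b p • monomial b (1 : ℚ) := by simp [smul_monomial]
    rw [h, ← TensorProduct.smul_tmul']
    refine smul _ _ (mon _ _ ?_)
    exact (DFunLike.congr_fun (Finsupp.degree_eq_weight_one (R := ℕ)) b).trans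
      (hp (mem_support_iff.1 hb))

theorem diffHom_mem_xHomogeneous {n d e : ℕ} {f : MvPolynomial (Fin n) ℚ} (hf : f.IsHomogeneous d)
    {t : Superspace n} (ht : t ∈ xHomogeneous n e) :
    diffHom n f t ∈ xHomogeneous n (e - d) ∧ (e < d → diffHom n f t = 0) := by
  rw [f.as_sum, map_sum, LinearMap.sum_apply]
  suffices h : ∀ m ∈ f.support, diffHom n (monomial m (coeff m f)) t ∈ xHomogeneous n (e - d) ∧
      (e < d → diffHom n (monomial m (coeff m f)) t = 0) from
    ⟨Submodule.sum_mem _ fun m hm => (h m hm).1,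
      fun hed => Finset.sum_eq_zero fun m hm => (h m hm).2 hed⟩
  intro m hm
  have hd := hf (mem_support_iff.1 hm)
  replace hd : m.degree = d :=
    (DFunLike.congr_fun (Finsupp.degree_eq_weight_one (R := ℕ)) m).trans hd
  have h : monomial m (coeff m f) = coeff m f • monomial m (1 : ℚ) := by simp [smul_monomial]
  rw [h, map_smul, LinearMap.smul_apply]
  suffices h1 : diffHom n (monomial m 1) t ∈ xHomogeneous n (e - d) ∧
      (e < d → diffHom n (monomial m 1) t = 0) from
    ⟨Submodule.smul_mem _ _ h1.1, fun hed => by rw [h1.2 hed, smul_zero]⟩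
  refine xHomogeneous_induction (P := fun t => diffHom n (monomial m 1) t ∈ xHomogeneous n (e - d) ∧
    (e < d → diffHom n (monomial m 1) t = 0)) ?_ ?_ ?_ ?_ ht
  · simp
  · rintro s t ⟨h1, h2⟩ ⟨h3, h4⟩
    rw [map_add]
    exact ⟨add_mem h1 h3, fun hed => by rw [h2 hed, h4 hed, add_zero]⟩
  · rintro c t ⟨h1, h2⟩
    rw [map_smul]
    exact ⟨Submodule.smul_mem _ _ h1, fun hed => by rw [h2 hed, smul_zero]⟩
  · intro b q hb
    obtain ⟨c, h1, h2⟩ := diffHom_monomial_tmul m b q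
    rw [h1]
    by_cases hle : m ≤ b
    · have h3 : (b - m).degree + m.degree = b.degree := by
        rw [← map_add, tsub_add_cancel_of_le hle]
      refine ⟨Submodule.smul_mem _ _ ?_, fun hed => absurd h3 (by omega)⟩
      rw [show e - d = (b - m).degree by omega]
      exact monomial_tmul_mem_xHomogeneous _ _
    · rw [h2 hle, zero_smul]
      exact ⟨zero_mem _, fun _ => rfl⟩

/-- The projection of superspace onto its part of `x`-degree `d`. -/
def xComponent (n d : ℕ) : Superspace n →ₗ[ℚ] Superspace n :=
  LinearMap.rTensor _ (homogeneousComponent d)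

theorem xComponent_tmul {n d : ℕ} (p : MvPolynomial (Fin n) ℚ)
    (q : ExteriorAlgebra ℚ (Fin n →₀ ℚ)) :
    xComponent n d (p ⊗ₜ q) = homogeneousComponent d p ⊗ₜ q := rfl

theorem xComponent_apply_of_mem {n d : ℕ} (e : ℕ) {t : Superspace n} (ht : t ∈ xHomogeneous n d) :
    xComponent n e t = if e = d then t else 0 := by
  refine xHomogeneous_induction (P := fun t => xComponent n e t = if e = d then t else 0)
    ?_ ?_ ?_ ?_ ht
  · simp
  · intro s t hs ht
    rw [map_add, hs, ht]
    split_ifs <;> simp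
  · intro c t ht
    rw [map_smul, ht]
    split_ifs <;> simp
  · intro b q hb
    have hm : (monomial b (1 : ℚ)) ∈ homogeneousSubmodule (Fin n) ℚ d :=
      isHomogeneous_monomial 1 hb
    rw [xComponent_tmul, homogeneousComponent_of_mem hm]
    split_ifs with h1
    · rfl
    · rw [TensorProduct.zero_tmul]

theorem contract_xComponent_zero {n : ℕ} (φ : ExteriorAlgebra ℚ (Fin n →₀ ℚ) →ₗ[ℚ] ℚ)
    (t : Superspace n) : coeff 0 (contract φ (xComponent n 0 t)) = coeff 0 (contract φ t) := by
  induction t using TensorProduct.induction_on with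
  | zero => simp
  | add s t hs ht => simp only [map_add, coeff_add, hs, ht]
  | tmul p q =>
    rw [xComponent_tmul, contract_tmul, contract_tmul, coeff_smul, coeff_smul,
      homogeneousComponent_zero, coeff_C, if_pos rfl]

/-- The component of `x`-degree `e` in `f(∂) t` comes from the component of degree `d - e` of `f`.
-/
theorem xComponent_diffHom {n d e : ℕ} (he : e ≤ d) (f : MvPolynomial (Fin n) ℚ) {t : Superspace n}
    (ht : t ∈ xHomogeneous n d) :
    xComponent n e (diffHom n f t) = diffHom n (homogeneousComponent (d - e) f) t := by
  conv_lhs => rw [← sum_homogeneousComponent f]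
  rw [map_sum, LinearMap.sum_apply, map_sum]
  have h : ∀ i, xComponent n e (diffHom n (homogeneousComponent i f) t) =
      if i = d - e then diffHom n (homogeneousComponent i f) t else 0 := by
    intro i
    obtain ⟨h1, h2⟩ := diffHom_mem_xHomogeneous (homogeneousComponent_isHomogeneous i f) ht
    rcases lt_or_ge d i with hi | hi
    · rw [h2 hi, map_zero, ite_self]
    · rw [xComponent_apply_of_mem e h1]
      exact if_congr (by omega) rfl rfl
  simp only [h]
  rw [Finset.sum_ite_eq']
  split_ifs with hmem
  · rfl
  · rw [homogeneousComponent_eq_zero _ _ (by rw [Finset.mem_range] at hmem; omega), map_zero,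
      LinearMap.zero_apply]

/-! ### The quotient ring and the module generated by the superspace Vandermonde -/

/-- The quotient ring is generated by finitely many nilpotent elements. -/
theorem finite_ringR (n k s : ℕ) : Module.Finite ℚ (RingR n k s) := by
  have hadj : Algebra.adjoin ℚ (Set.range fun i : Fin n =>
      (Ideal.Quotient.mkₐ ℚ (idealI n k s) (X i) : RingR n k s)) = ⊤ := by
    have h := congrArg (Subalgebra.map (Ideal.Quotient.mkₐ ℚ (idealI n k s)))
      (MvPolynomial.adjoin_range_X (R := ℚ) (σ := Fin n))
    rw [AlgHom.map_adjoin, ← Set.range_comp, Algebra.map_top,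
      (AlgHom.range_eq_top _).2 (Ideal.Quotient.mkₐ_surjective ℚ _)] at h
    exact h
  have hfg : (⊤ : Subalgebra ℚ (RingR n k s)).toSubmodule.FG := by
    rw [← hadj]
    refine fg_adjoin_of_finite (Set.finite_range _) ?_
    rintro _ ⟨i, rfl⟩
    refine ⟨Polynomial.X ^ s, Polynomial.monic_X_pow s, ?_⟩
    rw [Polynomial.eval₂_pow, Polynomial.eval₂_X, ← map_pow]
    exact Ideal.Quotient.eq_zero_iff_mem.2 (X_pow_mem_idealI k s i)
  exact ⟨by simpa using hfg⟩

/-- The map `f ↦ f(∂) t`. -/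
def diffAt {n : ℕ} (t : Superspace n) : MvPolynomial (Fin n) ℚ →ₗ[ℚ] Superspace n :=
  (LinearMap.applyₗ t) ∘ₗ (diffHom n).toLinearMap

@[simp]
theorem diffAt_apply {n : ℕ} (t : Superspace n) (f : MvPolynomial (Fin n) ℚ) :
    diffAt t f = diffHom n f t := rfl

/-- The smallest subspace containing `t` and closed under the `∂ᵢ` consists of the `f(∂) t`. -/
theorem cone_eq_range {n : ℕ} (t : Superspace n) : cone t = LinearMap.range (diffAt t) := by
  apply le_antisymm
  · refine sInf_le ⟨⟨1, by simp⟩, ?_⟩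
    rintro i _ ⟨f, rfl⟩
    exact ⟨X i * f, by rw [diffAt_apply, diffAt_apply, map_mul, diffHom_X, Module.End.mul_apply]⟩
  · refine le_sInf fun W hW => ?_
    rintro _ ⟨f, rfl⟩
    suffices h : ∀ u ∈ W, diffHom n f u ∈ W from h t hW.1
    induction f using MvPolynomial.induction_on with
    | C c =>
      intro u hu
      rw [← algebraMap_eq, AlgHom.commutes]
      exact Submodule.smul_mem _ c hu
    | add f g hf hg => exact fun u hu => by rw [map_add]; exact add_mem (hf u hu) (hg u hu)
    | mul_X f i hf =>
      exact fun u hu => by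
        rw [map_mul, diffHom_X]
        exact hf _ (hW.2 i u hu)

theorem vandermonde_mem_xHomogeneous {r : ℕ} (k : ℕ) (a : Fin r → ℕ) :
    vandermonde k a ∈ xHomogeneous (r + k) (stairExp k a).degree := by
  rw [vandermonde_eq]
  exact Submodule.sum_mem _ fun w _ => Submodule.smul_mem _ _
    (superRep_xHomogeneous w _ (monomial_tmul_mem_xHomogeneous _ _))

theorem block_ne_zero (s : ℕ) {n k : ℕ} {v : Fin k → Fin n} (hv : Function.Injective v) :
    block s v ≠ 0 := by
  refine mul_ne_zero (Finset.prod_ne_zero_iff.2 fun i _ => ?_)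
    (Finset.prod_ne_zero_iff.2 fun i _ => Finset.prod_ne_zero_iff.2 fun j hj => sub_ne_zero.2 ?_)
  · split_ifs
    · exact one_ne_zero
    · exact pow_ne_zero _ (X_ne_zero i)
  · rw [Ne, X_inj, hv.eq_iff]
    exact (Finset.mem_Ioi.1 hj).ne'

/-- The `x`-degree of the superspace Vandermonde for the constant sequence `s - 1`. -/
def topDegree (r k s : ℕ) : ℕ := (stairExp k fun _ : Fin r => s - 1).degree

/-- The module generated by the superspace Vandermonde reaches `x`-degree `0`. -/
theorem exists_mem_vanderPiece_zero (r k s : ℕ) :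
    ∃ t ∈ (vanderPiece k (fun _ : Fin r => s - 1) 0).toSubmodule, t ≠ 0 := by
  have hv : Function.Injective (Fin.natAdd r : Fin k → Fin (r + k)) := Fin.natAdd_injective k r
  obtain ⟨m, hm⟩ := MvPolynomial.exists_coeff_ne_zero (block_ne_zero s hv)
  obtain ⟨c, φ, hc, h⟩ := exists_contract_eq_block s hv
  have hΔ : _ ∈ xHomogeneous _ (topDegree r k s) :=
    vandermonde_mem_xHomogeneous k fun _ : Fin r => s - 1
  have h1 := xComponent_diffHom (Nat.zero_le _) (monomial m 1) hΔ
  have h2 := diffHom_mem_xHomogeneous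
    (homogeneousComponent_isHomogeneous (topDegree r k s - 0) (monomial m (1 : ℚ))) hΔ
  rw [← h1] at h2
  refine ⟨_, ⟨?_, by simpa using h2.1⟩, fun h0 => ?_⟩
  · rw [cone_eq_range, h1]
    exact ⟨_, rfl⟩
  · have h3 := contract_xComponent_zero φ
      (diffHom (r + k) (monomial m 1) (vandermonde k fun _ : Fin r => s - 1))
    rw [h0, map_zero, coeff_zero, coeff_zero_contract_diffHom, h, pair_smul_left,
      LinearMap.smul_apply, pair_monomial] at h3
    exact mul_ne_zero hc (mul_ne_zero (factorial_ne_zero m) hm) h3.symm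

/-- `f ↦ f(∂) Δ` induces a linear injection of the quotient ring into superspace. -/
theorem exists_ringR_hom {r k s : ℕ} (hks : k ≤ s) (hs : 0 < r → 0 < s) :
    ∃ Ψ : RingR (r + k) k s →ₗ[ℚ] Superspace (r + k), Function.Injective Ψ ∧
      ∀ f, Ψ (Ideal.Quotient.mkₐ ℚ _ f) = diffHom _ f (vandermonde k fun _ : Fin r => s - 1) := by
  have hsurj := Ideal.Quotient.mkₐ_surjective ℚ (idealI (r + k) k s)
  obtain ⟨σ, hσ⟩ := LinearMap.exists_rightInverse_of_surjective
    (Ideal.Quotient.mkₐ ℚ (idealI (r + k) k s)).toLinearMap (LinearMap.range_eq_top.2 hsurj)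
  have hσ' : ∀ x, Ideal.Quotient.mkₐ ℚ (idealI (r + k) k s) (σ x) = x := LinearMap.congr_fun hσ
  refine ⟨diffAt (vandermonde k fun _ : Fin r => s - 1) ∘ₗ σ, ?_, fun f => ?_⟩
  · rw [← LinearMap.ker_eq_bot, LinearMap.ker_eq_bot']
    intro x hx
    rw [← hσ' x]
    exact Ideal.Quotient.eq_zero_iff_mem.2 ((mem_idealI_iff hks hs _).2 hx)
  · have h1 : Ideal.Quotient.mkₐ ℚ (idealI (r + k) k s)
        (σ (Ideal.Quotient.mkₐ ℚ (idealI (r + k) k s) f) - f) = 0 := by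
      rw [map_sub, hσ', sub_self]
    have h2 := (mem_idealI_iff hks hs _).1 (Ideal.Quotient.eq_zero_iff_mem.1 h1)
    rw [LinearMap.comp_apply, diffAt_apply,
      ← sub_add_cancel (σ (Ideal.Quotient.mkₐ ℚ (idealI (r + k) k s) f)) f, map_add,
      LinearMap.add_apply, h2, zero_add]

theorem finite_vanderModule {r k s : ℕ} (hks : k ≤ s) (hs : 0 < r → 0 < s) :
    Module.Finite ℚ (vanderModule k fun _ : Fin r => s - 1).toSubmodule := by
  obtain ⟨Ψ, -, hΨ⟩ := exists_ringR_hom hks hs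
  have := finite_ringR (r + k) k s
  have h : (vanderModule k fun _ : Fin r => s - 1).toSubmodule = LinearMap.range Ψ := by
    refine (cone_eq_range _).trans (le_antisymm ?_ ?_)
    · rintro _ ⟨f, rfl⟩
      exact ⟨_, hΨ f⟩
    · rintro _ ⟨x, rfl⟩
      obtain ⟨f, rfl⟩ := Ideal.Quotient.mkₐ_surjective ℚ _ x
      exact ⟨f, (hΨ f).symm⟩
  rw [h]
  infer_instance

/-- The maps between the graded pieces of the quotient ring and those of the module generated by the
superspace Vandermonde: `f ↦ f(∂) Δ` reverses degrees and twists the action by the sign. -/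
theorem exists_pieceEquiv {r k s : ℕ} (hks : k ≤ s) (hs : 0 < r → 0 < s) {d : ℕ}
    (hd : d ≤ topDegree r k s) :
    ∃ e : (ringPiece (r + k) k s d).toSubmodule ≃ₗ[ℚ]
        (vanderPiece k (fun _ : Fin r => s - 1) (topDegree r k s - d)).toSubmodule,
      ∀ w x, e ((ringPiece (r + k) k s d).toRepresentation w x) =
        ((Equiv.Perm.sign w : ℤ) : ℚ) • (vanderPiece k (fun _ : Fin r => s - 1)
          (topDegree r k s - d)).toRepresentation w (e x) := by
  obtain ⟨Ψ, hinj, hΨ⟩ := exists_ringR_hom hks hs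
  have hΔ : _ ∈ xHomogeneous _ (topDegree r k s) :=
    vandermonde_mem_xHomogeneous k fun _ : Fin r => s - 1
  have hmaps : ∀ x ∈ (ringPiece (r + k) k s d).toSubmodule,
      Ψ x ∈ (vanderPiece k (fun _ : Fin r => s - 1) (topDegree r k s - d)).toSubmodule := by
    rintro _ ⟨p, hp, rfl⟩
    rw [AlgHom.toLinearMap_apply, hΨ]
    refine ⟨?_, (diffHom_mem_xHomogeneous hp hΔ).1⟩
    rw [cone_eq_range]
    exact ⟨p, rfl⟩
  refine ⟨LinearEquiv.ofBijective (Ψ.restrict hmaps) ⟨fun x y h => ?_, ?_⟩, ?_⟩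
  · exact Subtype.ext (hinj (congrArg Subtype.val h))
  · rintro ⟨t, ht, ht'⟩
    rw [cone_eq_range] at ht
    obtain ⟨f, rfl⟩ := ht
    refine ⟨⟨_, homogeneousComponent d f, homogeneousComponent_isHomogeneous d f, rfl⟩,
      Subtype.ext ?_⟩
    change Ψ (Ideal.Quotient.mkₐ ℚ _ (homogeneousComponent d f)) = _
    have h1 := xComponent_diffHom (Nat.sub_le (topDegree r k s) d) f hΔ
    rw [← diffAt_apply, xComponent_apply_of_mem _ ht', if_pos rfl, Nat.sub_sub_self hd] at h1
    rw [hΨ, ← h1]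
  · rintro w ⟨_, p, hp, rfl⟩
    refine Subtype.ext ?_
    change Ψ (Ideal.Quotient.mkₐ ℚ _ (rename w p)) =
      _ • superRep (r + k) w (Ψ (Ideal.Quotient.mkₐ ℚ _ p))
    have h1 : superRep (r + k) w (vandermonde k fun _ : Fin r => s - 1) = _ :=
      superRep_antisymmetrize _ _
    rw [hΨ, hΨ, superRep_diffHom, h1, map_smul, smul_smul, ← Int.cast_mul, ← Units.val_mul,
      Int.units_mul_self, Units.val_one, Int.cast_one, one_smul]
    rfl

theorem ringPiece_eq_bot {r k s : ℕ} (hks : k ≤ s) (hs : 0 < r → 0 < s) {d : ℕ}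
    (hd : topDegree r k s < d) : (ringPiece (r + k) k s d).toSubmodule = ⊥ := by
  rw [eq_bot_iff]
  rintro _ ⟨p, hp, rfl⟩
  refine Ideal.Quotient.eq_zero_iff_mem.2 ((mem_idealI_iff hks hs _).2 ?_)
  exact (diffHom_mem_xHomogeneous hp (vandermonde_mem_xHomogeneous k fun _ : Fin r => s - 1)).2 hd

theorem vanderPiece_eq_bot {r k s d : ℕ} (hd : topDegree r k s < d) :
    (vanderPiece k (fun _ : Fin r => s - 1) d).toSubmodule = ⊥ := by
  rw [eq_bot_iff]
  rintro t ⟨ht, ht'⟩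
  rw [cone_eq_range] at ht
  obtain ⟨f, rfl⟩ := ht
  have hΔ : _ ∈ xHomogeneous _ (topDegree r k s) :=
    vandermonde_mem_xHomogeneous k fun _ : Fin r => s - 1
  have h1 := xComponent_apply_of_mem d ht'
  rw [if_pos rfl, diffAt_apply, ← sum_homogeneousComponent f, map_sum, LinearMap.sum_apply,
    map_sum] at h1
  rw [Submodule.mem_bot, diffAt_apply, ← sum_homogeneousComponent f, map_sum, LinearMap.sum_apply,
    ← h1]
  refine Finset.sum_eq_zero fun i _ => ?_
  have h2 := diffHom_mem_xHomogeneous (homogeneousComponent_isHomogeneous i f) hΔ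
  rw [xComponent_apply_of_mem d h2.1, if_neg (by omega)]

/-! ### Positivity in the rational group algebra -/

section GroupAlgebra

variable {G : Type*} [Group G]

/-- The anti-automorphism `g ↦ g⁻¹` of the group algebra. -/
def adjHom (G : Type*) [Group G] : MonoidAlgebra ℚ G →ₐ[ℚ] (MonoidAlgebra ℚ G)ᵐᵒᵖ :=
  MonoidAlgebra.lift ℚ _ G
    { toFun := fun g => MulOpposite.op (MonoidAlgebra.single g⁻¹ 1)
      map_one' := by rw [inv_one]; rfl
      map_mul' := fun g h => by
        rw [← MulOpposite.op_mul, MonoidAlgebra.single_mul_single, mul_one, mul_inv_rev] }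

/-- The element `∑ x_g g⁻¹` attached to `x = ∑ x_g g`. -/
def adj (x : MonoidAlgebra ℚ G) : MonoidAlgebra ℚ G := (adjHom G x).unop

theorem adj_mul (x y : MonoidAlgebra ℚ G) : adj (x * y) = adj y * adj x := by
  rw [adj, map_mul, MulOpposite.unop_mul]
  rfl

theorem adj_add (x y : MonoidAlgebra ℚ G) : adj (x + y) = adj x + adj y := by
  rw [adj, map_add, MulOpposite.unop_add]
  rfl

theorem adj_zero : adj (0 : MonoidAlgebra ℚ G) = 0 := by
  rw [adj, map_zero, MulOpposite.unop_zero]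

theorem adj_single (g : G) (c : ℚ) :
    adj (MonoidAlgebra.single g c) = MonoidAlgebra.single g⁻¹ c := by
  rw [adj, adjHom, MonoidAlgebra.lift_single, MulOpposite.unop_smul]
  change c • MonoidAlgebra.single g⁻¹ (1 : ℚ) = _
  rw [MonoidAlgebra.smul_single', mul_one]

theorem adj_sum {ι : Type*} (s : Finset ι) (f : ι → MonoidAlgebra ℚ G) :
    adj (∑ i ∈ s, f i) = ∑ i ∈ s, adj (f i) := by
  rw [adj, map_sum, Finset.unop_sum]
  rfl

theorem adj_adj (x : MonoidAlgebra ℚ G) : adj (adj x) = x := by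
  induction x using MonoidAlgebra.induction_linear with
  | zero => rw [adj_zero, adj_zero]
  | add x y hx hy => rw [adj_add, adj_add, hx, hy]
  | single g c => rw [adj_single, adj_single, inv_inv]

theorem coeff_adj (x : MonoidAlgebra ℚ G) (g : G) : (adj x).coeff g = x.coeff g⁻¹ := by
  classical
  induction x using MonoidAlgebra.induction_linear with
  | zero => rw [adj_zero]; rfl
  | add x y hx hy =>
    rw [adj_add, MonoidAlgebra.coeff_add, MonoidAlgebra.coeff_add, Finsupp.add_apply,
      Finsupp.add_apply, hx, hy]
  | single h c =>
    rw [adj_single, MonoidAlgebra.coeff_single, Finsupp.single_apply, MonoidAlgebra.coeff_single,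
      Finsupp.single_apply]
    exact if_congr inv_eq_iff_eq_inv rfl rfl

variable [Fintype G]

theorem coeff_mul_one (x y : MonoidAlgebra ℚ G) :
    (x * y).coeff 1 = ∑ g, x.coeff g * y.coeff g⁻¹ := by
  classical
  induction x using MonoidAlgebra.induction_linear with
  | zero => simp
  | add x x' hx hy =>
    simp only [add_mul, MonoidAlgebra.coeff_add, Finsupp.add_apply, hx, hy, Finset.sum_add_distrib]
  | single g c =>
    simp only [MonoidAlgebra.coeff_single, Finsupp.single_apply, ite_mul, zero_mul]
    rw [Finset.sum_ite_eq, if_pos (Finset.mem_univ g)]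
    rw [MonoidAlgebra.coeff_single_mul_eq_mul_coeff g⁻¹]
    intro h _
    rw [mul_eq_one_iff_inv_eq, eq_comm]

/-- The coefficient of `1` in `x x*` is the sum of the squares of the coefficients of `x`. -/
theorem eq_zero_of_mul_adj {x : MonoidAlgebra ℚ G} (h : x * adj x = 0) : x = 0 := by
  have h1 := coeff_mul_one x (adj x)
  rw [h] at h1
  simp only [coeff_adj, inv_inv] at h1
  have h2 := (Finset.sum_eq_zero_iff_of_nonneg fun g _ => mul_self_nonneg (x.coeff g)).1 h1.symm
  refine MonoidAlgebra.coeff_injective (Finsupp.ext fun g => ?_)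
  exact mul_self_eq_zero.1 (h2 g (Finset.mem_univ g))

/-- Positivity: `y y* y = 0` only for `y = 0`; in particular `y A y = 0` only for `y = 0`. -/
theorem eq_zero_of_mul_adj_mul {y : MonoidAlgebra ℚ G} (h : y * adj y * y = 0) : y = 0 := by
  apply eq_zero_of_mul_adj
  apply eq_zero_of_mul_adj
  rw [adj_mul, adj_adj, ← mul_assoc, h, zero_mul]

/-- A central element with square zero vanishes. -/
theorem eq_zero_of_central_of_mul_self {z : MonoidAlgebra ℚ G} (hc : ∀ x, z * x = x * z)
    (h : z * z = 0) : z = 0 := by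
  apply eq_zero_of_mul_adj_mul
  rw [hc]
  rw [mul_assoc, h, mul_zero]

/-- The sum `∑ χ(σ) σ` over the permutations `σ` preserving the function `f`. -/
def fiberSum {n : ℕ} (f : Fin n → ℕ) (χ : Equiv.Perm (Fin n) →* ℤˣ) : GroupAlg n :=
  ∑ σ : Equiv.Perm (Fin n) with ∀ i, f (σ i) = f i, MonoidAlgebra.single σ ((χ σ : ℤ) : ℚ)

end GroupAlgebra

section

variable {n : ℕ}

theorem single_mul_fiberSum {f : Fin n → ℕ} (χ : Equiv.Perm (Fin n) →* ℤˣ)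
    {τ : Equiv.Perm (Fin n)} (hτ : ∀ i, f (τ i) = f i) :
    MonoidAlgebra.single τ 1 * fiberSum f χ = ((χ τ : ℤ) : ℚ) • fiberSum f χ := by
  rw [fiberSum, Finset.mul_sum, Finset.smul_sum]
  refine Finset.sum_equiv (Equiv.mulLeft τ) (fun σ => ?_) fun σ _ => ?_
  · simp [hτ]
  · rw [MonoidAlgebra.single_mul_single, MonoidAlgebra.smul_single', Equiv.coe_mulLeft, map_mul,
      one_mul, Units.val_mul, Int.cast_mul, ← mul_assoc, ← Int.cast_mul,
      ← Units.val_mul, Int.units_mul_self, Units.val_one, Int.cast_one, one_mul]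

theorem fiberSum_mul_single {f : Fin n → ℕ} (χ : Equiv.Perm (Fin n) →* ℤˣ)
    {τ : Equiv.Perm (Fin n)} (hτ : ∀ i, f (τ i) = f i) :
    fiberSum f χ * MonoidAlgebra.single τ 1 = ((χ τ : ℤ) : ℚ) • fiberSum f χ := by
  rw [fiberSum, Finset.sum_mul, Finset.smul_sum]
  refine Finset.sum_equiv (Equiv.mulRight τ) (fun σ => ?_) fun σ _ => ?_
  · simp only [Finset.mem_filter, Finset.mem_univ, true_and, Equiv.coe_mulRight,
      Equiv.Perm.mul_apply]
    refine ⟨fun h i => (h _).trans (hτ i), fun h i => ?_⟩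
    have h1 := h (τ⁻¹ i)
    have h2 := hτ (τ⁻¹ i)
    rw [Equiv.Perm.coe_inv, Equiv.apply_symm_apply] at h1 h2
    rw [h1, h2]
  · rw [MonoidAlgebra.single_mul_single, MonoidAlgebra.smul_single', Equiv.coe_mulRight, map_mul,
      mul_one, mul_comm (χ σ), Units.val_mul, Int.cast_mul, ← mul_assoc, ← Int.cast_mul,
      ← Units.val_mul, Int.units_mul_self, Units.val_one, Int.cast_one, one_mul]

theorem fiberSum_mul_self (f : Fin n → ℕ) (χ : Equiv.Perm (Fin n) →* ℤˣ) :
    ∃ c : ℚ, c ≠ 0 ∧ fiberSum f χ * fiberSum f χ = c • fiberSum f χ := by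
  refine ⟨((Finset.univ.filter fun σ : Equiv.Perm (Fin n) => ∀ i, f (σ i) = f i).card : ℚ),
    Nat.cast_ne_zero.2 (Finset.card_ne_zero_of_mem (a := 1) (by simp)), ?_⟩
  conv_lhs => enter [1]; rw [fiberSum]
  rw [Finset.sum_mul]
  rw [Nat.cast_smul_eq_nsmul, ← Finset.sum_const]
  refine Finset.sum_congr rfl fun σ hσ => ?_
  have h : MonoidAlgebra.single σ ((χ σ : ℤ) : ℚ) =
      ((χ σ : ℤ) : ℚ) • MonoidAlgebra.single σ (1 : ℚ) := by
    rw [MonoidAlgebra.smul_single', mul_one]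
  rw [h, smul_mul_assoc, single_mul_fiberSum χ (Finset.mem_filter.1 hσ).2, smul_smul,
    ← Int.cast_mul, ← Units.val_mul, Int.units_mul_self, Units.val_one, Int.cast_one, one_smul]

theorem adj_fiberSum (f : Fin n → ℕ) (χ : Equiv.Perm (Fin n) →* ℤˣ) :
    adj (fiberSum f χ) = fiberSum f χ := by
  rw [fiberSum, adj_sum]
  refine Finset.sum_equiv (Equiv.inv _) (fun σ => ?_) fun σ _ => ?_
  · simp only [Finset.mem_filter, Finset.mem_univ, true_and, Equiv.inv_apply]
    refine ⟨fun h i => ?_, fun h i => ?_⟩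
    · rw [← h, Equiv.Perm.coe_inv, Equiv.apply_symm_apply]
    · rw [← h (σ i), Equiv.Perm.coe_inv, Equiv.symm_apply_apply]
  · rw [adj_single, Equiv.inv_apply, map_inv, Int.units_inv_eq_self]

/-- The sum for a relabelled function is conjugate to the original one. -/
theorem fiberSum_comp (f : Fin n → ℕ) (χ : Equiv.Perm (Fin n) →* ℤˣ) (π : Equiv.Perm (Fin n)) :
    fiberSum (f ∘ π) χ * MonoidAlgebra.single π⁻¹ 1 =
      MonoidAlgebra.single π⁻¹ 1 * fiberSum f χ := by
  rw [fiberSum, fiberSum, Finset.sum_mul, Finset.mul_sum]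
  refine Finset.sum_equiv (MulAut.conj π).toEquiv (fun σ => ?_) fun σ _ => ?_
  · simp only [Finset.mem_filter, Finset.mem_univ, true_and, MulEquiv.toEquiv_eq_coe,
      MulEquiv.coe_toEquiv, MulAut.conj_apply, Equiv.Perm.mul_apply, Function.comp_apply]
    refine ⟨fun h i => ?_, fun h i => ?_⟩
    · rw [h, Equiv.Perm.coe_inv, Equiv.apply_symm_apply]
    · simpa using h (π i)
  · have h : χ (MulAut.conj π σ) = χ σ := by
      rw [MulAut.conj_apply, map_mul, map_mul, mul_comm (χ π), mul_assoc, ← map_mul,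
        mul_inv_cancel, map_one, mul_one]
    rw [MonoidAlgebra.single_mul_single, MonoidAlgebra.single_mul_single]
    change _ = MonoidAlgebra.single (π⁻¹ * MulAut.conj π σ) (1 * ((χ (MulAut.conj π σ) : ℤ) : ℚ))
    rw [h, MulAut.conj_apply, mul_one, one_mul, mul_assoc, inv_mul_cancel_left]

/-- The automorphism `g ↦ sign(g) g` of the group algebra. -/
def signTwist (n : ℕ) : GroupAlg n →ₐ[ℚ] GroupAlg n :=
  MonoidAlgebra.lift ℚ _ _
    { toFun := fun g => MonoidAlgebra.single g ((Equiv.Perm.sign g : ℤ) : ℚ)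
      map_one' := by simp [MonoidAlgebra.one_def]
      map_mul' := fun g h => by
        rw [MonoidAlgebra.single_mul_single, Equiv.Perm.sign_mul, Units.val_mul, Int.cast_mul] }

theorem signTwist_single (g : Equiv.Perm (Fin n)) (c : ℚ) :
    signTwist n (MonoidAlgebra.single g c) =
      MonoidAlgebra.single g (c * ((Equiv.Perm.sign g : ℤ) : ℚ)) := by
  rw [signTwist, MonoidAlgebra.lift_single]
  exact MonoidAlgebra.smul_single' _ _ _

theorem signTwist_signTwist (x : GroupAlg n) : signTwist n (signTwist n x) = x := by
  induction x using MonoidAlgebra.induction_linear with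
  | zero => simp
  | add x y hx hy => simp [hx, hy]
  | single g c =>
    rw [signTwist_single, signTwist_single, mul_assoc, ← Int.cast_mul, ← Units.val_mul,
      Int.units_mul_self, Units.val_one, Int.cast_one, mul_one]

theorem signTwist_fiberSum (f : Fin n → ℕ) (χ : Equiv.Perm (Fin n) →* ℤˣ) :
    signTwist n (fiberSum f χ) = fiberSum f (χ * Equiv.Perm.sign) := by
  rw [fiberSum, fiberSum, map_sum]
  refine Finset.sum_congr rfl fun σ _ => ?_
  rw [signTwist_single, MonoidHom.mul_apply, Units.val_mul, Int.cast_mul]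

theorem youngSymmetrizer_eq {μ : YoungDiagram} (T : μ.cells ≃ Fin n) :
    youngSymmetrizer T = fiberSum (fun i => (T.symm i).1.1) 1 *
      fiberSum (fun i => (T.symm i).1.2) Equiv.Perm.sign := by
  simp [youngSymmetrizer, fiberSum]

/-! ### Transposing a diagram twists the representation by the sign -/

/-- For `a`, `b` the row and column sums of `T`, right multiplication by `b` maps `A b a`
injectively into `A a b`, because `u b = 0` and `u ∈ A b a` give `u u* = 0`. Up to a relabelling
of the entries, the sign twist of the left ideal of a filling of the transposed shape is `A b a`.
-/
theorem exists_signTwist_mul {μ ν : YoungDiagram} (hν : ν = μ.transpose) (T : μ.cells ≃ Fin n)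
    (U : ν.cells ≃ Fin n) :
    ∃ z : GroupAlg n, ∀ x ∈ spechtIdeal U, signTwist n x * z ∈ spechtIdeal T ∧
      (signTwist n x * z = 0 → x = 0) := by
  subst hν
  let π : Equiv.Perm (Fin n) := (U.symm.trans
    ((Equiv.prodComm ℕ ℕ).subtypeEquiv fun c => by simp [YoungDiagram.mem_transpose])).trans T
  have h1 : (fun i => (U.symm i).1.1) = (fun i => (T.symm i).1.2) ∘ π := by
    funext i
    simp [π]
  have h2 : (fun i => (U.symm i).1.2) = (fun i => (T.symm i).1.1) ∘ π := by
    funext i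
    simp [π]
  set a := fiberSum (fun i => (T.symm i).1.1) 1 with ha
  set b := fiberSum (fun i => (T.symm i).1.2) Equiv.Perm.sign with hb
  refine ⟨MonoidAlgebra.single π⁻¹ 1 * b, fun x hx => ?_⟩
  obtain ⟨y, rfl⟩ := Submodule.mem_span_singleton.1 hx
  have hsq : (Equiv.Perm.sign * Equiv.Perm.sign : Equiv.Perm (Fin n) →* ℤˣ) = 1 := by
    ext g
    simp
  obtain ⟨u, hu⟩ : ∃ u, u = signTwist n y * MonoidAlgebra.single π⁻¹ 1 * b * a := ⟨_, rfl⟩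
  have hx' : signTwist n (y • youngSymmetrizer U) * MonoidAlgebra.single π⁻¹ 1 = u := by
    rw [smul_eq_mul, map_mul, youngSymmetrizer_eq, map_mul, signTwist_fiberSum, signTwist_fiberSum,
      h1, h2, hsq, one_mul, mul_assoc, mul_assoc, fiberSum_comp, ← mul_assoc _ _ (fiberSum _ 1),
      fiberSum_comp, ← ha, ← hb, hu]
    simp only [mul_assoc]
  rw [← mul_assoc, hx']
  constructor
  · rw [hu, mul_assoc, hb, ha, ← youngSymmetrizer_eq]
    exact Submodule.smul_mem _ _ (Submodule.mem_span_singleton_self _)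
  · intro h
    obtain ⟨c, hc, haa⟩ := fiberSum_mul_self (fun i => (T.symm i).1.1) 1
    have hu0 : u = 0 := by
      apply eq_zero_of_mul_adj
      have h3 : adj u = a * (b * adj (signTwist n y * MonoidAlgebra.single π⁻¹ 1)) := by
        rw [hu, adj_mul, adj_mul, ha, hb, adj_fiberSum, adj_fiberSum]
      have h4 : u * a = c • u := by
        rw [hu, mul_assoc, ha, haa, mul_smul_comm]
      rw [h3, ← mul_assoc, h4, smul_mul_assoc, ← mul_assoc, h, zero_mul, smul_zero]
    rw [hu0] at hx'
    have h5 := congrArg (· * MonoidAlgebra.single π (1 : ℚ)) hx'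
    simp only [zero_mul, mul_assoc, MonoidAlgebra.single_mul_single, inv_mul_cancel, mul_one,
      ← MonoidAlgebra.one_def] at h5
    rw [← signTwist_signTwist (y • youngSymmetrizer U), h5, map_zero]

instance {μ : YoungDiagram} (T : μ.cells ≃ Fin n) : Module.Finite ℚ (spechtIdeal T) :=
  Module.Finite.of_injective ((spechtIdeal T).subtype.restrictScalars ℚ) Subtype.val_injective

theorem specht_apply {μ : YoungDiagram} (T : μ.cells ≃ Fin n) (w : Equiv.Perm (Fin n))
    (x : spechtIdeal T) : ((specht T w x : spechtIdeal T) : GroupAlg n) =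
      MonoidAlgebra.single w 1 * (x : GroupAlg n) := by
  rfl

/-- `S^{μ'}` is the sign twist of `S^μ`. -/
theorem exists_spechtEquiv {μ ν : YoungDiagram} (hν : ν = μ.transpose) (T : μ.cells ≃ Fin n)
    (U : ν.cells ≃ Fin n) :
    ∃ e : spechtIdeal U ≃ₗ[ℚ] spechtIdeal T,
      ∀ w x, e (specht U w x) = ((Equiv.Perm.sign w : ℤ) : ℚ) • specht T w (e x) := by
  have key : ∀ {μ ν : YoungDiagram} (_ : ν = μ.transpose) (T : μ.cells ≃ Fin n)
      (U : ν.cells ≃ Fin n), ∃ e : spechtIdeal U →ₗ[ℚ] spechtIdeal T, Function.Injective e ∧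
        ∀ w x, e (specht U w x) = ((Equiv.Perm.sign w : ℤ) : ℚ) • specht T w (e x) := by
    intro μ ν hν T U
    obtain ⟨z, hz⟩ := exists_signTwist_mul hν T U
    let e : spechtIdeal U →ₗ[ℚ] spechtIdeal T :=
      { toFun := fun x => ⟨signTwist n x * z, (hz x x.2).1⟩
        map_add' := fun x y => Subtype.ext (by
          simp only [Submodule.coe_add, map_add, add_mul])
        map_smul' := fun c x => Subtype.ext (by
          change signTwist n (c • (x : GroupAlg n)) * z = c • (signTwist n x * z)
          rw [map_smul, smul_mul_assoc]) }
    refine ⟨e, (injective_iff_map_eq_zero e).2 fun x hx =>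
      Subtype.ext ((hz x x.2).2 (congrArg Subtype.val hx)), fun w x => Subtype.ext ?_⟩
    change signTwist n (MonoidAlgebra.single w 1 * (x : GroupAlg n)) * z =
      _ • (MonoidAlgebra.single w 1 * (signTwist n (x : GroupAlg n) * z))
    rw [map_mul, signTwist_single, one_mul, ← mul_assoc, ← smul_mul_assoc, ← smul_mul_assoc,
      MonoidAlgebra.smul_single', mul_one]
  obtain ⟨e, he, h⟩ := key hν T U
  obtain ⟨e', he', -⟩ := key (YoungDiagram.transpose_eq_iff_eq_transpose.1 hν.symm) U T
  -- The construction also applies to the transpose of the transpose, so the dimensions agree.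
  have hd := le_antisymm (LinearMap.finrank_le_finrank_of_injective he)
    (LinearMap.finrank_le_finrank_of_injective he')
  exact ⟨LinearEquiv.ofInjectiveOfFinrankEq e he hd, h⟩

theorem card_transpose (μ : YoungDiagram) : μ.transpose.cells.card = μ.cells.card := by
  refine Finset.card_equiv (Equiv.prodComm ℕ ℕ) fun c => ?_
  rw [YoungDiagram.mem_cells, YoungDiagram.mem_cells, YoungDiagram.mem_transpose]
  rfl

variable {M N : Type*} [AddCommGroup M] [Module ℚ M] [AddCommGroup N] [Module ℚ N]

theorem multiplicity_transpose {ρ : Representation ℚ (Equiv.Perm (Fin n)) M}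
    {σ : Representation ℚ (Equiv.Perm (Fin n)) N} (e : M ≃ₗ[ℚ] N)
    (he : ∀ w x, e (ρ w x) = ((Equiv.Perm.sign w : ℤ) : ℚ) • σ w (e x)) (μ : YoungDiagram) :
    multiplicity σ μ.transpose = multiplicity ρ μ := by
  by_cases h : μ.cells.card = n
  · have h' : μ.transpose.cells.card = n := (card_transpose μ).trans h
    rw [multiplicity, multiplicity, dif_pos h, dif_pos h']
    obtain ⟨E, hE⟩ := exists_spechtEquiv rfl (μ.cells.equivFinOfCardEq h)
      (μ.transpose.cells.equivFinOfCardEq h')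
    have hE' : ∀ w x, E.symm (specht _ w x) =
        ((Equiv.Perm.sign w : ℤ) : ℚ) • specht _ w (E.symm x) := fun w x => by
      apply E.injective
      rw [map_smul, hE, E.apply_symm_apply, E.apply_symm_apply, smul_smul, ← Int.cast_mul,
        ← Units.val_mul, Int.units_mul_self, Units.val_one, Int.cast_one, one_smul]
    have he' : ∀ w x, e.symm (σ w x) = ((Equiv.Perm.sign w : ℤ) : ℚ) • ρ w (e.symm x) :=
      fun w x => by
        apply e.injective
        rw [map_smul, he, e.apply_symm_apply, e.apply_symm_apply, smul_smul, ← Int.cast_mul,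
          ← Units.val_mul, Int.units_mul_self, Units.val_one, Int.cast_one, one_smul]
    have h1 : ∀ f : Representation.IntertwiningMap (specht (μ.cells.equivFinOfCardEq h)) ρ,
        ∀ w x, (e.toLinearMap ∘ₗ f.toLinearMap ∘ₗ E.toLinearMap) (specht _ w x) =
          σ w ((e.toLinearMap ∘ₗ f.toLinearMap ∘ₗ E.toLinearMap) x) := fun f w x => by
      change e (f (E (specht _ w x))) = σ w (e (f (E x)))
      rw [hE, map_smul, f.isIntertwining, map_smul, he, smul_smul, ← Int.cast_mul,
        ← Units.val_mul, Int.units_mul_self, Units.val_one, Int.cast_one, one_smul]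
    have h2 : ∀ f : Representation.IntertwiningMap
        (specht (μ.transpose.cells.equivFinOfCardEq h')) σ,
        ∀ w x, (e.symm.toLinearMap ∘ₗ f.toLinearMap ∘ₗ E.symm.toLinearMap) (specht _ w x) =
          ρ w ((e.symm.toLinearMap ∘ₗ f.toLinearMap ∘ₗ E.symm.toLinearMap) x) := fun f w x => by
      change e.symm (f (E.symm (specht _ w x))) = ρ w (e.symm (f (E.symm x)))
      rw [hE', map_smul, f.isIntertwining, map_smul, he', smul_smul, ← Int.cast_mul,
        ← Units.val_mul, Int.units_mul_self, Units.val_one, Int.cast_one, one_smul]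
    exact LinearEquiv.finrank_eq
      { toFun := fun f => LinearMap.intertwiningMap_of_isIntertwiningMap _ _ _ (h2 f)
        invFun := fun f => LinearMap.intertwiningMap_of_isIntertwiningMap _ _ _ (h1 f)
        map_add' := fun f g => Representation.IntertwiningMap.ext (LinearMap.ext fun x =>
          map_add e.symm _ _)
        map_smul' := fun c f => Representation.IntertwiningMap.ext (LinearMap.ext fun x =>
          map_smul e.symm _ _)
        left_inv := fun f => Representation.IntertwiningMap.ext (LinearMap.ext fun x => by
          change e (e.symm (f (E.symm (E x)))) = f x
          rw [E.symm_apply_apply, e.apply_symm_apply])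
        right_inv := fun f => Representation.IntertwiningMap.ext (LinearMap.ext fun x => by
          change e.symm (e (f (E (E.symm x)))) = f x
          rw [E.apply_symm_apply, e.symm_apply_apply]) }
  · rw [multiplicity, multiplicity, dif_neg h, dif_neg (by rwa [card_transpose])]

theorem mem_partitionsOf {μ : YoungDiagram} : μ ∈ partitionsOf n ↔ μ.card = n := by
  simp [partitionsOf]

/-- Twisting a representation by the sign applies `ω` to its Frobenius image. -/
theorem omega_frob {ρ : Representation ℚ (Equiv.Perm (Fin n)) M}
    {σ : Representation ℚ (Equiv.Perm (Fin n)) N} (e : M ≃ₗ[ℚ] N)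
    (he : ∀ w x, e (ρ w x) = ((Equiv.Perm.sign w : ℤ) : ℚ) • σ w (e x)) :
    omega (frob ρ) = frob σ := by
  rw [frob, frob, map_sum]
  refine Finset.sum_equiv YoungDiagram.transposeOrderIso.toEquiv (fun μ => ?_) fun μ _ => ?_
  · rw [mem_partitionsOf, mem_partitionsOf]
    change _ ↔ μ.transpose.cells.card = n
    rw [card_transpose]
  · change _ = (multiplicity σ μ.transpose : ℚ) • schurBasis μ.transpose
    rw [map_smul, omega_schurBasis, multiplicity_transpose e he]

end

/-! ### Completeness of the representations `S^μ` -/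

section

variable {n : ℕ}

/-- In a column of `T` meeting the fibres of `f` at most once, at most `m` entries have `f < m`,
and at most the whole column. -/
theorem card_column_inter_le {μ : YoungDiagram} (T : μ.cells ≃ Fin n) {f : Fin n → ℕ}
    (hf : ∀ i j, i ≠ j → (T.symm i).1.2 = (T.symm j).1.2 → f i ≠ f j) (m c : ℕ) :
    (Finset.univ.filter fun i => f i < m ∧ (T.symm i).1.2 = c).card ≤
      (Finset.univ.filter fun i => (T.symm i).1.1 < m ∧ (T.symm i).1.2 = c).card := by
  rcases le_or_gt (μ.colLen c) m with h | h
  · refine Finset.card_le_card fun i hi => ?_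
    rw [Finset.mem_filter] at hi ⊢
    refine ⟨hi.1, ?_, hi.2.2⟩
    have h1 : ((T.symm i).1.1, (T.symm i).1.2) ∈ μ := (YoungDiagram.mem_cells _).1 (T.symm i).2
    rw [hi.2.2] at h1
    exact (YoungDiagram.mem_iff_lt_colLen.1 h1).trans_le h
  · have h1 : (Finset.univ.filter fun i => f i < m ∧ (T.symm i).1.2 = c).card ≤
        (Finset.range m).card := by
      refine Finset.card_le_card_of_injOn f (fun i hi => ?_) fun i hi j hj hij => ?_
      · have := (Finset.mem_filter.1 hi).2.1
        simpa using this
      · by_contra hne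
        exact hf i j hne ((Finset.mem_filter.1 hi).2.2.trans (Finset.mem_filter.1 hj).2.2.symm) hij
    refine h1.trans (Finset.card_le_card_of_surjOn (fun i => (T.symm i).1.1) fun t ht => ?_)
    have ht' : t < m := by simpa using ht
    have hmem : (t, c) ∈ μ.cells :=
      (YoungDiagram.mem_cells _).2 (YoungDiagram.mem_iff_lt_colLen.2 (ht'.trans h))
    exact ⟨T ⟨(t, c), hmem⟩, by simp [ht'], by simp⟩

/-- The number of cells in the first `m` rows, counted by their entries. -/
theorem topCells_eq {μ : YoungDiagram} (T : μ.cells ≃ Fin n) (m : ℕ) :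
    topCells μ m = (Finset.univ.filter fun i => (T.symm i).1.1 < m).card := by
  refine Finset.card_bij' (fun c hc => T ⟨c, (Finset.mem_filter.1 hc).1⟩)
    (fun i _ => (T.symm i).1) (fun c hc => ?_) (fun i hi => ?_) (fun c hc => ?_) fun i hi => ?_
  · simpa using (Finset.mem_filter.1 hc).2
  · exact Finset.mem_filter.2 ⟨(T.symm i).2, (Finset.mem_filter.1 hi).2⟩
  · simp
  · simp

/-- If entries in one column of `T` always lie in different rows of `U`, then the shape of `T`
dominates the shape of `U`. -/
theorem topCells_le_of_injective {μ ν : YoungDiagram} (T : μ.cells ≃ Fin n) (U : ν.cells ≃ Fin n)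
    (h : ∀ i j, i ≠ j → (T.symm i).1.2 = (T.symm j).1.2 → (U.symm i).1.1 ≠ (U.symm j).1.1) :
    topCells ν ≤ topCells μ := by
  intro m
  rw [topCells_eq T, topCells_eq U]
  have hmaps : ∀ s : Finset (Fin n), ∀ i ∈ s, (T.symm i).1.2 ∈
      Finset.univ.image fun i => (T.symm i).1.2 :=
    fun s i _ => Finset.mem_image_of_mem _ (Finset.mem_univ i)
  rw [Finset.card_eq_sum_card_fiberwise (hmaps _), Finset.card_eq_sum_card_fiberwise (hmaps _)]
  refine Finset.sum_le_sum fun c _ => ?_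
  rw [Finset.filter_filter, Finset.filter_filter]
  exact card_column_inter_le T h m c

/-- Two entries in one column of `T` and one row of `U` give a transposition `τ` with `b τ = -b` and
`τ a = a`, so that `b a = 0`. -/
theorem colSum_mul_rowSum {μ ν : YoungDiagram} (T : μ.cells ≃ Fin n) (U : ν.cells ≃ Fin n)
    (h : ¬ topCells ν ≤ topCells μ) :
    fiberSum (fun i => (T.symm i).1.2) Equiv.Perm.sign * fiberSum (fun i => (U.symm i).1.1) 1 =
      0 := by
  obtain ⟨i, j, hij, h1, h2⟩ : ∃ i j, i ≠ j ∧ (T.symm i).1.2 = (T.symm j).1.2 ∧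
      (U.symm i).1.1 = (U.symm j).1.1 := by
    by_contra hcon
    push Not at hcon
    exact h (topCells_le_of_injective T U hcon)
  have hs : ∀ f : Fin n → ℕ, f i = f j → ∀ l, f (Equiv.swap i j l) = f l := by
    intro f hf l
    rw [Equiv.swap_apply_def]
    split_ifs with h3 h4
    · rw [h3, hf]
    · rw [h4, hf]
    · rfl
  have h3 := fiberSum_mul_single (f := fun i => (T.symm i).1.2) Equiv.Perm.sign
    (hs (fun i => (T.symm i).1.2) h1)
  have h4 := single_mul_fiberSum (f := fun i => (U.symm i).1.1) 1 (hs (fun i => (U.symm i).1.1) h2)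
  rw [Equiv.Perm.sign_swap hij] at h3
  have h5 := congrArg (· * fiberSum (fun i => (U.symm i).1.1) 1) h3
  simp only [mul_assoc, h4, MonoidHom.one_apply] at h5
  simp only [Units.val_one, Int.cast_one, one_smul, Units.val_neg, Int.cast_neg, neg_smul,
    neg_mul] at h5
  refine (smul_eq_zero.1 (?_ : (2 : ℚ) • (_ : GroupAlg n) = 0)).resolve_left two_ne_zero
  rw [two_smul]
  nth_rewrite 1 [h5]
  exact neg_add_cancel _

theorem colSum_mul_mul_rowSum {μ ν : YoungDiagram} (T : μ.cells ≃ Fin n) (U : ν.cells ≃ Fin n)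
    (h : ¬ topCells ν ≤ topCells μ) (x : GroupAlg n) :
    fiberSum (fun i => (T.symm i).1.2) Equiv.Perm.sign *
      (x * fiberSum (fun i => (U.symm i).1.1) 1) = 0 := by
  induction x using MonoidAlgebra.induction_linear with
  | zero => simp
  | add x y hx hy => rw [add_mul, mul_add, hx, hy, add_zero]
  | single g c =>
    have h1 := fiberSum_comp (fun i => (U.symm i).1.1) 1 g⁻¹
    rw [inv_inv] at h1
    have h2 : MonoidAlgebra.single g c = c • MonoidAlgebra.single g (1 : ℚ) := by
      rw [MonoidAlgebra.smul_single', mul_one]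
    have h3 := colSum_mul_rowSum T (U.trans g) h
    have h4 : (fun i => ((U.trans g).symm i).1.1) = (fun i => (U.symm i).1.1) ∘ ⇑g⁻¹ := rfl
    rw [h2, smul_mul_assoc, mul_smul_comm, ← h1, ← mul_assoc, ← h4, h3, zero_mul, smul_zero]

/-- Young symmetrizers of different shapes are orthogonal. -/
theorem youngSymmetrizer_mul_mul {μ ν : YoungDiagram} (hne : μ ≠ ν) (T : μ.cells ≃ Fin n)
    (U : ν.cells ≃ Fin n) (x : GroupAlg n) :
    youngSymmetrizer T * x * youngSymmetrizer U = 0 := by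
  have key : ∀ {μ ν : YoungDiagram} (T : μ.cells ≃ Fin n) (U : ν.cells ≃ Fin n),
      ¬ topCells ν ≤ topCells μ → ∀ x, youngSymmetrizer T * x * youngSymmetrizer U = 0 := by
    intro μ ν T U h x
    have h1 := colSum_mul_mul_rowSum T U h x
    rw [youngSymmetrizer_eq, youngSymmetrizer_eq, mul_assoc, mul_assoc, ← mul_assoc x,
      ← mul_assoc (fiberSum _ Equiv.Perm.sign), h1, zero_mul, mul_zero]
  by_cases h : topCells ν ≤ topCells μ
  · have h' : ¬ topCells μ ≤ topCells ν := fun h1 => hne (topCells_injective (le_antisymm h1 h))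
    -- The product `y` satisfies `y A y = 0` by the other order of the shapes.
    apply eq_zero_of_mul_adj_mul
    have h2 := key U T h' (adj (youngSymmetrizer T * x * youngSymmetrizer U))
    obtain ⟨y, hy⟩ : ∃ y, y = youngSymmetrizer T * x * youngSymmetrizer U := ⟨_, rfl⟩
    rw [← hy] at h2 ⊢
    have h3 : y * adj y * y =
        youngSymmetrizer T * x * (youngSymmetrizer U * adj y * youngSymmetrizer T) * x *
          youngSymmetrizer U :=
      calc y * adj y * y = (youngSymmetrizer T * x * youngSymmetrizer U) * adj y *
            (youngSymmetrizer T * x * youngSymmetrizer U) := by rw [← hy]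
        _ = _ := by simp only [mul_assoc]
    rw [h3, h2, mul_zero, zero_mul, zero_mul]
  · exact key T U h x

theorem coeff_fiberSum (f : Fin n → ℕ) (χ : Equiv.Perm (Fin n) →* ℤˣ) (g : Equiv.Perm (Fin n)) :
    (fiberSum f χ).coeff g = if ∀ i, f (g i) = f i then ((χ g : ℤ) : ℚ) else 0 := by
  rw [fiberSum, MonoidAlgebra.coeff_sum, Finsupp.finsetSum_apply]
  simp only [MonoidAlgebra.coeff_single, Finsupp.single_apply]
  rw [Finset.sum_ite_eq']
  simp

/-- Only the identity preserves all rows and columns, so it has coefficient `1` in the Young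
symmetrizer. -/
theorem coeff_youngSymmetrizer_one {μ : YoungDiagram} (T : μ.cells ≃ Fin n) :
    (youngSymmetrizer T).coeff 1 = 1 := by
  rw [youngSymmetrizer_eq, coeff_mul_one, Finset.sum_eq_single_of_mem 1 (Finset.mem_univ _)]
  · simp [coeff_fiberSum]
  · intro g _ hg
    rw [coeff_fiberSum, coeff_fiberSum]
    split_ifs with h1 h2
    · refine absurd (Equiv.ext fun i => ?_) hg
      -- A permutation preserving both rows and columns is the identity.
      have h3 : (T.symm (g i)).1.2 = (T.symm i).1.2 := by
        simpa using (h2 (g i)).symm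
      exact T.symm.injective (Subtype.ext (Prod.ext (h1 i) h3))
    · simp
    · simp
    · simp

/-- The central element `∑ g c g⁻¹` attached to the Young symmetrizer `c` of a filling. -/
def centralYoung {μ : YoungDiagram} (T : μ.cells ≃ Fin n) : GroupAlg n :=
  ∑ g : Equiv.Perm (Fin n),
    MonoidAlgebra.single g 1 * youngSymmetrizer T * MonoidAlgebra.single g⁻¹ 1

theorem single_mul_centralYoung {μ : YoungDiagram} (T : μ.cells ≃ Fin n) (h : Equiv.Perm (Fin n)) :
    MonoidAlgebra.single h 1 * centralYoung T = centralYoung T * MonoidAlgebra.single h 1 := by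
  rw [centralYoung, Finset.mul_sum, Finset.sum_mul]
  refine Fintype.sum_equiv (Equiv.mulLeft h) _ _ fun g => ?_
  rw [Equiv.coe_mulLeft, mul_assoc _ _ (MonoidAlgebra.single h 1), MonoidAlgebra.single_mul_single,
    mul_inv_rev, inv_mul_cancel_right, ← mul_assoc, ← mul_assoc, MonoidAlgebra.single_mul_single,
    mul_one]

theorem centralYoung_mul_comm {μ : YoungDiagram} (T : μ.cells ≃ Fin n) (x : GroupAlg n) :
    centralYoung T * x = x * centralYoung T := by
  induction x using MonoidAlgebra.induction_linear with
  | zero => simp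
  | add x y hx hy => rw [add_mul, mul_add, hx, hy]
  | single g c =>
    have h2 : MonoidAlgebra.single g c = c • MonoidAlgebra.single g (1 : ℚ) := by
      rw [MonoidAlgebra.smul_single', mul_one]
    rw [h2, smul_mul_assoc, mul_smul_comm, single_mul_centralYoung]

theorem centralYoung_ne_zero {μ : YoungDiagram} (T : μ.cells ≃ Fin n) : centralYoung T ≠ 0 := by
  intro h
  have h1 : (centralYoung T).coeff 1 = (n.factorial : ℚ) := by
    rw [centralYoung, MonoidAlgebra.coeff_sum, Finsupp.finsetSum_apply]
    have : ∀ g : Equiv.Perm (Fin n), (MonoidAlgebra.single g (1 : ℚ) * youngSymmetrizer T *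
        MonoidAlgebra.single g⁻¹ 1).coeff 1 = 1 := by
      intro g
      rw [MonoidAlgebra.coeff_mul_single_apply, MonoidAlgebra.coeff_single_mul_apply]
      simp [coeff_youngSymmetrizer_one]
    simp [this, Fintype.card_perm]
  rw [h] at h1
  exact Nat.cast_ne_zero.2 n.factorial_ne_zero h1.symm

theorem centralYoung_mul_of_ne {μ ν : YoungDiagram} (hne : μ ≠ ν) (T : μ.cells ≃ Fin n)
    (U : ν.cells ≃ Fin n) : centralYoung T * centralYoung U = 0 := by
  rw [centralYoung, centralYoung, Finset.sum_mul]
  refine Finset.sum_eq_zero fun g _ => ?_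
  rw [Finset.mul_sum]
  refine Finset.sum_eq_zero fun h _ => ?_
  have h1 := youngSymmetrizer_mul_mul hne T U
    (MonoidAlgebra.single g⁻¹ 1 * MonoidAlgebra.single h 1)
  have h2 : MonoidAlgebra.single g 1 * youngSymmetrizer T * MonoidAlgebra.single g⁻¹ 1 *
      (MonoidAlgebra.single h 1 * youngSymmetrizer U * MonoidAlgebra.single h⁻¹ (1 : ℚ)) =
      MonoidAlgebra.single g 1 * (youngSymmetrizer T * (MonoidAlgebra.single g⁻¹ 1 *
        MonoidAlgebra.single h 1) * youngSymmetrizer U) * MonoidAlgebra.single h⁻¹ (1 : ℚ) := by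
    simp only [mul_assoc]
  rw [h2, h1, mul_zero, zero_mul]

theorem coeff_eq_of_isConj {z : GroupAlg n} (hz : ∀ x, z * x = x * z)
    {g h : Equiv.Perm (Fin n)} (hgh : IsConj g h) : z.coeff g = z.coeff h := by
  obtain ⟨c, rfl⟩ := isConj_iff.1 hgh
  have h1 := congrArg (fun y => y.coeff (c * g)) (hz (MonoidAlgebra.single c 1))
  simpa [MonoidAlgebra.coeff_mul_single_apply, MonoidAlgebra.coeff_single_mul_apply] using h1.symm

/-- The Young diagram whose row lengths are the cycle lengths of `σ`. -/
def cycleDiagram (σ : Equiv.Perm (Fin n)) : YoungDiagram :=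
  YoungDiagram.ofRowLens (σ.partition.parts.sort (· ≥ ·)) (Multiset.pairwise_sort _ _).sortedGE

theorem card_ofRowLens (w : List ℕ) (hw : w.SortedGE) :
    (YoungDiagram.ofRowLens w hw).card = w.sum := by
  change (YoungDiagram.cellsOfRowLens w).card = _
  clear hw
  induction w with
  | nil => rfl
  | cons a w ih =>
    rw [YoungDiagram.cellsOfRowLens, Finset.card_union_of_disjoint, Finset.card_map, ih,
      Finset.card_product]
    · simp
    · rw [Finset.disjoint_left]
      rintro ⟨i, j⟩ h1 h2
      simp at h1 h2
      omega

theorem cycleDiagram_mem (σ : Equiv.Perm (Fin n)) : cycleDiagram σ ∈ partitionsOf n := by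
  rw [mem_partitionsOf, cycleDiagram, card_ofRowLens, ← Multiset.sum_coe, Multiset.sort_eq,
    σ.partition.parts_sum, Fintype.card_fin]

/-- Conjugacy classes of `𝔖ₙ` are determined by their cycle types. -/
theorem isConj_of_cycleDiagram_eq {σ τ : Equiv.Perm (Fin n)}
    (h : cycleDiagram σ = cycleDiagram τ) : IsConj σ τ := by
  rw [Equiv.Perm.partition_eq_of_isConj]
  have h1 := congrArg YoungDiagram.rowLens h
  rw [cycleDiagram, cycleDiagram, YoungDiagram.rowLens_ofRowLens_eq_self,
    YoungDiagram.rowLens_ofRowLens_eq_self] at h1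
  · have h2 := congrArg (fun l : List ℕ => (l : Multiset ℕ)) h1
    simp only [Multiset.sort_eq] at h2
    exact Nat.Partition.ext h2
  · exact fun x hx => τ.partition.parts_pos ((Multiset.mem_sort _).1 hx)
  · exact fun x hx => σ.partition.parts_pos ((Multiset.mem_sort _).1 hx)

theorem card_conjClasses_le (n : ℕ) :
    Nat.card (ConjClasses (Equiv.Perm (Fin n))) ≤ Nat.card (partitionsOf n) := by
  refine Nat.card_le_card_of_injective (fun c => ⟨cycleDiagram (Quotient.out c),
    cycleDiagram_mem _⟩) fun c d h => ?_
  have h1 := isConj_of_cycleDiagram_eq (congrArg Subtype.val h)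
  rw [← Quotient.out_eq c, ← Quotient.out_eq d]
  exact Quotient.sound h1

/-- The central elements attached to the diagrams with `n` cells. -/
def centralFamily (n : ℕ) (μ : partitionsOf n) : GroupAlg n :=
  centralYoung (μ.1.cells.equivFinOfCardEq (mem_partitionsOf.1 μ.2))

/-- Reading a central element on representatives of the conjugacy classes. -/
def classValues (n : ℕ) : GroupAlg n →ₗ[ℚ] (ConjClasses (Equiv.Perm (Fin n)) → ℚ) where
  toFun x c := x.coeff (Quotient.out c)
  map_add' _ _ := rfl
  map_smul' _ _ := rfl

/-- A central element is a class function, hence determined by its values on representatives. -/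
theorem eq_zero_of_classValues {z : GroupAlg n} (hz : ∀ x, z * x = x * z)
    (h : classValues n z = 0) : z = 0 := by
  refine MonoidAlgebra.coeff_injective (Finsupp.ext fun g => ?_)
  have h1 : IsConj g (Quotient.out (ConjClasses.mk g)) :=
    ConjClasses.mk_eq_mk_iff_isConj.1 (Quotient.out_eq (ConjClasses.mk g)).symm
  rw [coeff_eq_of_isConj hz h1]
  exact congrFun h (ConjClasses.mk g)

theorem sum_centralFamily_mul_comm (c : partitionsOf n → ℚ) (x : GroupAlg n) :
    (∑ μ, c μ • centralFamily n μ) * x = x * ∑ μ, c μ • centralFamily n μ := by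
  rw [Finset.sum_mul, Finset.mul_sum]
  refine Finset.sum_congr rfl fun μ _ => ?_
  rw [smul_mul_assoc, mul_smul_comm, centralFamily, centralYoung_mul_comm]

/-- The central elements attached to different diagrams are orthogonal and not nilpotent. -/
theorem linearIndependent_classValues (n : ℕ) :
    LinearIndependent ℚ fun μ : partitionsOf n => classValues n (centralFamily n μ) := by
  rw [Fintype.linearIndependent_iff]
  intro c hc ν
  have h0 : ∑ μ, c μ • centralFamily n μ = 0 := by
    refine eq_zero_of_classValues (sum_centralFamily_mul_comm c) ?_
    rw [map_sum, ← hc]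
    exact Finset.sum_congr rfl fun μ _ => map_smul _ _ _
  have h1 := congrArg (· * centralFamily n ν) h0
  simp only [Finset.sum_mul, zero_mul] at h1
  rw [Finset.sum_eq_single_of_mem ν (Finset.mem_univ ν)] at h1
  · rw [smul_mul_assoc] at h1
    refine (smul_eq_zero.1 h1).resolve_right fun h2 => centralYoung_ne_zero _
      (eq_zero_of_central_of_mul_self (centralYoung_mul_comm _) h2)
  · intro μ _ hμ
    rw [smul_mul_assoc, centralFamily, centralFamily,
      centralYoung_mul_of_ne fun h => hμ (Subtype.ext h), smul_zero]

/-- The unit is a combination of the central elements attached to the diagrams with `n` cells: there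
are as many diagrams as conjugacy classes. -/
theorem exists_sum_centralFamily_eq_one (n : ℕ) :
    ∃ c : partitionsOf n → ℚ, ∑ μ, c μ • centralFamily n μ = 1 := by
  classical
  have hli := linearIndependent_classValues n
  have hcard : Fintype.card (partitionsOf n) =
      Module.finrank ℚ (ConjClasses (Equiv.Perm (Fin n)) → ℚ) := by
    refine le_antisymm hli.fintype_card_le_finrank ?_
    have := card_conjClasses_le n
    rwa [Module.finrank_fintype_fun_eq_card, ← Nat.card_eq_fintype_card,
      ← Nat.card_eq_fintype_card]
  have hspan := hli.span_eq_top_of_card_eq_finrank' hcard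
  have h1 : classValues n 1 ∈ Submodule.span ℚ
      (Set.range fun μ : partitionsOf n => classValues n (centralFamily n μ)) := by
    rw [hspan]
    trivial
  obtain ⟨c, hc⟩ := (Submodule.mem_span_range_iff_exists_fun ℚ).1 h1
  refine ⟨c, ?_⟩
  rw [← sub_eq_zero]
  refine eq_zero_of_classValues (fun x => ?_) ?_
  · rw [sub_mul, mul_sub, sum_centralFamily_mul_comm, one_mul, mul_one]
  · rw [map_sub, ← hc, map_sum, sub_eq_zero]
    exact Finset.sum_congr rfl fun μ _ => map_smul _ _ _

variable {M : Type*} [AddCommGroup M] [Module ℚ M]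

/-- A vector `u` with `c u ≠ 0`, `c` the Young symmetrizer, gives the nonzero intertwining map
`x ↦ x u`. -/
theorem finrank_intertwiningMap_ne_zero [Module.Finite ℚ M] {μ : YoungDiagram}
    (T : μ.cells ≃ Fin n) (ρ : Representation ℚ (Equiv.Perm (Fin n)) M) {u : M}
    (hu : ρ.asAlgebraHom (youngSymmetrizer T) u ≠ 0) :
    Module.finrank ℚ (Representation.IntertwiningMap (specht T) ρ) ≠ 0 := by
  obtain ⟨φ, hφ'⟩ : ∃ φ : spechtIdeal T →ₗ[ℚ] M,
      ∀ x, φ x = ρ.asAlgebraHom (x : GroupAlg n) u :=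
    ⟨{ toFun := fun x => ρ.asAlgebraHom (x : GroupAlg n) u
       map_add' := fun x y => by rw [Submodule.coe_add, map_add, LinearMap.add_apply]
       map_smul' := fun c x => by
        rw [RingHom.id_apply, ← LinearMap.smul_apply, ← map_smul]
        rfl }, fun _ => rfl⟩
  have hφ : ∀ w x, (φ : spechtIdeal T →ₗ[ℚ] M) (specht T w x) = ρ w (φ x) := by
    intro w x
    rw [hφ', hφ', specht_apply, map_mul, Representation.asAlgebraHom_single_one]
    rfl
  let Φ : Representation.IntertwiningMap (specht T) ρ :=
    LinearMap.intertwiningMap_of_isIntertwiningMap _ _ φ hφ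
  have hΦ : Φ ≠ 0 := by
    intro h
    have h1 : Φ ⟨youngSymmetrizer T, Submodule.mem_span_singleton_self _⟩ = 0 := by
      rw [h]
      rfl
    change φ _ = 0 at h1
    rw [hφ'] at h1
    exact hu h1
  have : Module.Finite ℚ (Representation.IntertwiningMap (specht T) ρ) :=
    Module.Finite.of_injective (Representation.IntertwiningMap.toLinearMapl (specht T) ρ)
      (Representation.IntertwiningMap.toLinearMap_injective _ _)
  have : Nontrivial (Representation.IntertwiningMap (specht T) ρ) := ⟨Φ, 0, hΦ⟩
  exact Module.finrank_pos.ne'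

/-- The Frobenius image of a nonzero representation is nonzero. -/
theorem frob_ne_zero [Module.Finite ℚ M] [Nontrivial M]
    (ρ : Representation ℚ (Equiv.Perm (Fin n)) M) : frob ρ ≠ 0 := by
  obtain ⟨x, hx⟩ := exists_ne (0 : M)
  obtain ⟨c, hc⟩ := exists_sum_centralFamily_eq_one n
  obtain ⟨μ, hμ⟩ : ∃ μ, ρ.asAlgebraHom (centralFamily n μ) x ≠ 0 := by
    by_contra! hcon
    apply hx
    have h1 := congrArg (fun y => ρ.asAlgebraHom y x) hc
    simp only [map_sum, map_smul, map_one, LinearMap.sum_apply, LinearMap.smul_apply, hcon,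
      smul_zero, Finset.sum_const_zero] at h1
    exact h1.symm
  have hcard := mem_partitionsOf.1 μ.2
  obtain ⟨g, hg⟩ : ∃ g : Equiv.Perm (Fin n), ρ.asAlgebraHom
      (youngSymmetrizer (μ.1.cells.equivFinOfCardEq hcard)) (ρ g⁻¹ x) ≠ 0 := by
    by_contra! hcon
    apply hμ
    rw [centralFamily, centralYoung, map_sum, LinearMap.sum_apply]
    refine Finset.sum_eq_zero fun g _ => ?_
    rw [map_mul, map_mul, Module.End.mul_apply, Module.End.mul_apply,
      Representation.asAlgebraHom_single_one, Representation.asAlgebraHom_single_one, hcon,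
      map_zero]
  have hm : multiplicity ρ μ.1 ≠ 0 := by
    rw [multiplicity, dif_pos hcard]
    exact finrank_intertwiningMap_ne_zero _ ρ hg
  intro h
  have h1 := linearIndependent_iff'.1 schurBasis.linearIndependent (partitionsOf n)
    (fun μ => (multiplicity ρ μ : ℚ)) h μ.1 μ.2
  exact hm (Nat.cast_eq_zero.1 h1)

theorem frob_eq_zero [Subsingleton M] (ρ : Representation ℚ (Equiv.Perm (Fin n)) M) :
    frob ρ = 0 := by
  refine Finset.sum_eq_zero fun μ _ => ?_
  have h : multiplicity ρ μ = 0 := by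
    rw [multiplicity]
    split_ifs
    · have : Subsingleton (Representation.IntertwiningMap
          (specht (μ.cells.equivFinOfCardEq ‹_›)) ρ) :=
        (Representation.IntertwiningMap.toLinearMap_injective _ _).subsingleton
      exact Module.finrank_zero_of_subsingleton
    · rfl
  rw [h, Nat.cast_zero, zero_smul]

end

/-! ### Comparison of the graded Frobenius images -/

section

variable {n : ℕ} {M N : Type*} [AddCommGroup M] [Module ℚ M] [AddCommGroup N] [Module ℚ N]
  {ρ : Representation ℚ (Equiv.Perm (Fin n)) M} {σ : Representation ℚ (Equiv.Perm (Fin n)) N}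

/-- A sign-twisted isomorphism of graded pieces. -/
theorem omega_grFrob {𝒜 : ℕ → Subrepresentation ρ} {ℬ : ℕ → Subrepresentation σ} {d d' : ℕ}
    (e : (𝒜 d).toSubmodule ≃ₗ[ℚ] (ℬ d').toSubmodule)
    (he : ∀ w x, e ((𝒜 d).toRepresentation w x) =
      ((Equiv.Perm.sign w : ℤ) : ℚ) • (ℬ d').toRepresentation w (e x)) :
    omega (grFrob 𝒜 d) = grFrob ℬ d' :=
  omega_frob e he

theorem grFrob_eq_zero {𝒜 : ℕ → Subrepresentation ρ} {d : ℕ} (h : (𝒜 d).toSubmodule = ⊥) :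
    grFrob 𝒜 d = 0 := by
  have : Subsingleton (𝒜 d).toSubmodule := (Submodule.subsingleton_iff_eq_bot).2 h
  exact frob_eq_zero _

theorem grFrob_ne_zero {𝒜 : ℕ → Subrepresentation ρ} {d : ℕ}
    (hfin : Module.Finite ℚ (𝒜 d).toSubmodule) {x : M} (hx : x ∈ (𝒜 d).toSubmodule)
    (hx0 : x ≠ 0) : grFrob 𝒜 d ≠ 0 := by
  have : Nontrivial (𝒜 d).toSubmodule := ⟨⟨x, hx⟩, 0, fun h => hx0 (congrArg Subtype.val h)⟩
  exact frob_ne_zero _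

end

theorem omega_grFrob_ringPiece {r k s : ℕ} (hks : k ≤ s) (hs : 0 < r → 0 < s) {d : ℕ}
    (hd : d ≤ topDegree r k s) :
    omega (grFrob (ringPiece (r + k) k s) d) =
      grFrob (vanderPiece k fun _ : Fin r => s - 1) (topDegree r k s - d) := by
  obtain ⟨e, he⟩ := exists_pieceEquiv hks hs hd
  exact omega_grFrob e he

theorem grFrob_vanderPiece_zero_ne_zero {r k s : ℕ} (hks : k ≤ s) (hs : 0 < r → 0 < s) :
    grFrob (vanderPiece k fun _ : Fin r => s - 1) 0 ≠ 0 := by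
  have h := finite_vanderModule hks hs
  obtain ⟨t, ht, h0⟩ := exists_mem_vanderPiece_zero r k s
  exact grFrob_ne_zero (Submodule.finiteDimensional_of_le
    (S₂ := (vanderModule k fun _ : Fin r => s - 1).toSubmodule) inf_le_left) ht h0

/-- The top degree of `R_{n,k,s}` is that of `Δₙ`: it pairs with the constants in `Vₙ`, whose
Frobenius image is nonzero. -/
theorem qDegree_ringR {r k s : ℕ} (hks : k ≤ s) (hs : 0 < r → 0 < s) :
    qDegree (fun d => omega (grFrob (ringPiece (r + k) k s) d)) = topDegree r k s := by
  refine IsGreatest.csSup_eq ⟨?_, fun d hd => ?_⟩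
  · change omega (grFrob _ _) ≠ 0
    rw [omega_grFrob_ringPiece hks hs le_rfl, Nat.sub_self]
    exact grFrob_vanderPiece_zero_ne_zero hks hs
  · by_contra hlt
    refine hd ?_
    dsimp only
    rw [grFrob_eq_zero (ringPiece_eq_bot hks hs (not_le.1 hlt)), map_zero]

/-- The pieces of `Vₙ` in degree `i` and of the quotient ring in degree `topDegree - i`
correspond, and both vanish beyond the top degree. -/
theorem grFrob_vanderPiece {r k s : ℕ} (hks : k ≤ s) (hs : 0 < r → 0 < s) :
    grFrob (vanderPiece k fun _ : Fin r => s - 1) =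
      revq fun d => omega (grFrob (ringPiece (r + k) k s) d) := by
  funext i
  rw [revq, qDegree_ringR hks hs]
  split_ifs with h
  · rw [omega_grFrob_ringPiece hks hs (Nat.sub_le _ _), Nat.sub_sub_self h]
  · exact grFrob_eq_zero (vanderPiece_eq_bot (not_le.1 h))

end SuperVandermonde

end

theorem theorem4p2 (r k s : ℕ) (hks : k ≤ s) (a : Fin r → ℕ)
    (ha : ∀ i, (a i : ℤ) = (s : ℤ) - 1) :
    Module.Finite ℚ (SuperVandermonde.vanderModule k a).toSubmodule ∧
    Module.Finite ℚ (SuperVandermonde.RingR (r + k) k s) ∧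
    (∀ f : MvPolynomial (Fin (r + k)) ℚ,
      f ∈ SuperVandermonde.idealI (r + k) k s ↔
        SuperVandermonde.diffOp f (SuperVandermonde.vandermonde k a) = 0) ∧
    SuperVandermonde.grFrob (SuperVandermonde.vanderPiece k a) =
      SuperVandermonde.revq (fun d =>
        SuperVandermonde.omega
          (SuperVandermonde.grFrob (SuperVandermonde.ringPiece (r + k) k s) d)) := by
  obtain rfl : a = fun _ => s - 1 := funext fun i => by
    have := ha i
    omega
  have hs : 0 < r → 0 < s := fun hr => by
    have := ha ⟨0, hr⟩
    omega
  refine ⟨SuperVandermonde.finite_vanderModule hks hs, SuperVandermonde.finite_ringR _ _ _,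
    fun f => ?_, SuperVandermonde.grFrob_vanderPiece hks hs⟩
  rw [SuperVandermonde.diffOp_eq]
  exact SuperVandermonde.mem_idealI_iff hks hs f
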